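/- Let $N\ge 1$, $T>0$, $\lambda>0$, $\mathsf a\in\mathbb R^N$, and let $$g_\lambda(\mathsf x,t,\mathsf y)=\Big(\frac{\lambda}{2\pi\sinh(\lambda t)}\Big)^{N/2}\exp\Big[-\frac{\lambda\big(\cosh(\lambda t)(|\mathsf x|^2+|\mathsf y|^2)-2(\mathsf x,\mathsf y)\big)}{2\sinh(\lambda t)}\Big]$$ be Mehler's kernel. It is a positive, jointly continuous Green function of $\partial_t u=\frac12\Delta u-\frac{\lambda^2}{2}|\mathsf x|^2u$: for $t>0$ it is positive, jointly continuous, $C^2$ in $\mathsf x$ and solves the equation in $(\mathsf x,t)$, and $\int g_\lambda(\mathsf x,t,\mathsf y)f(\mathsf y)\,d\mathsf y\to f(\mathsf x)$ as $t\to0_+$ for every continuous compactly supported $f$ and every $\mathsf x$. Consider the forward equation on $\mathbb R^N\times(0,T]$ with initial datum $\varphi=\mathsf m_\lambda\delta_0$, and the adjoint backward equation $-\partial_t v=\frac12\Delta v-\frac{\lambda^2}{2}|\mathsf x|^2v$ on $\mathbb R^N\times[0,T)$ with final datum $\psi=\mathsf m_\lambda\delta_{\mathsf a}$, where $$\mathsf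 m_\lambda=\Big(\frac{2\pi\sinh(\lambda T)}{\lambda}\Big)^{N/4}\exp\Big[\frac{\lambda\coth(\lambda T)|\mathsf a|^2}{4}\Big].$$ An $\mathbb R^N$-valued process $(Z_\tau)_{\tau\in[0,T]}$ on a probability space $(\Omega,\mathcal F,\mathbb P)$ is called a Bernstein process associated with this system if (i) for all $0\le s<r<t\le T$ and every bounded Borel $f$, $\mathbb E\big(f(Z_r)\mid\sigma(Z_\tau:\tau\le s\text{ or }\tau\ge t)\big)=\mathbb E\big(f(Z_r)\mid Z_s,Z_t\big)$ a.s.; (ii) for all such $s,r,t$ and every Borel set $E$, $\mathbb P(Z_r\in E\mid Z_s,Z_t)=\int_E \frac{g_\lambda(Z_t,t-r,\mathsf z)\,g_\lambda(\mathsf z,r-s,Z_s)}{g_\lambda(Z_t,t-s,Z_s)}\,d\mathsf z$ a.s.; (iii) the joint law of $(Z_0,Z_T)$ is $d\mu(\mathsf x,\mathsf y)=g_\lambda(\mathsf x,T,\mathsf y)\,d(\varphi\otimes\psi)(\mathsf x,\mathsf y)$. Such a process exists on some complete probability space. Every such process is Gaussian and Markovian and satisfies, with $\mathsf a_\lambda(t)=\frac{\sinh(\lambda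 t)}{\sinh(\lambda T)}\mathsf a$ and $\sigma_\lambda(t)=\frac{\sinh(\lambda(T-t))\sinh(\lambda t)}{\lambda\sinh(\lambda T)}$: (1) $\displaystyle\mathbb P(Z_t\in E)=(2\pi\sigma_\lambda(t))^{-N/2}\int_E\exp\Big[-\frac{|\mathsf x-\mathsf a_\lambda(t)|^2}{2\sigma_\lambda(t)}\Big]d\mathsf x$ for all $t\in(0,T)$ and all Borel sets $E$; (2) $\mathbb P(Z_0=0)=\mathbb P(Z_T=\mathsf a)=1$; (3) $\mathbb E(Z_t)=\mathsf a_\lambda(t)$ for all $t\in[0,T]$, and for all $s,t\in[0,T]$ and $i,j\in\{1,\dots,N\}$, $$\mathbb E\big((Z_s^i-a_\lambda^i(s))(Z_t^j-a_\lambda^j(t))\big)=\frac{\sinh(\lambda(T-s\vee t))\,\sinh(\lambda(s\wedge t))}{\lambda\sinh(\lambda T)}\,\delta_{i,j};$$ (4) $Z$ is not (strictly) stationary, and its randomness is maximal exactly at $t=T/2$: for every $i$, $\operatorname{Var}(Z^i_{T/2})=\frac{\sinh^2(\lambda T/2)}{\lambda\sinh(\lambda T)}$ and $\operatorname{Var}(Z^i_t)<\operatorname{Var}(Z^i_{T/2})$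 for every $t\in[0,T]$ with $t\neq T/2$. -/

import Mathlib

open MeasureTheory ProbabilityTheory Filter Topology
open scoped Laplacian

namespace BernsteinBridge

/-- The σ-algebra generated by the process up to and including time `s`. -/
abbrev past {I Ω E : Type*} [Preorder I] [MeasurableSpace E] (Z : I → Ω → E) (s : I) :
    MeasurableSpace Ω :=
  ⨆ τ : I, ⨆ _ : τ ≤ s, MeasurableSpace.comap (Z τ) inferInstance

/-- The σ-algebra generated by the process from time `t` on. -/
abbrev future {I Ω E : Type*} [Preorder I] [MeasurableSpace E] (Z : I → Ω → E) (t : I) :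
    MeasurableSpace Ω :=
  ⨆ τ : I, ⨆ _ : t ≤ τ, MeasurableSpace.comap (Z τ) inferInstance

/-- The σ-algebra generated by the pair `(Z s, Z t)`. -/
abbrev pairSigma {I Ω E : Type*} [MeasurableSpace E] (Z : I → Ω → E) (s t : I) :
    MeasurableSpace Ω :=
  MeasurableSpace.comap (fun ω => (Z s ω, Z t ω)) inferInstance

/-- `Z` is a Bernstein (reciprocal) process under `P`: given the whole past of `s` and the whole
future of `t`, the state at an intermediate time `r` depends only on the pair `(Z s, Z t)`. -/
structure IsBernsteinProcess {I Ω E : Type*} [Preorder I] [MeasurableSpace E]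
    [MeasurableSpace Ω] (Z : I → Ω → E) (P : Measure Ω) : Prop where
  measurable : ∀ t, Measurable (Z t)
  reciprocal : ∀ f : E → ℝ, Measurable f → (∃ C : ℝ, ∀ x, |f x| ≤ C) →
    ∀ s r t : I, s < r → r < t →
      P[fun ω => f (Z r ω) | past Z s ⊔ future Z t] =ᵐ[P] P[fun ω => f (Z r ω) | pairSigma Z s t]

/-- `Z` is a Markov process under `P`: given the whole past of `s`, the state at a later time `t`
depends only on `Z s`. -/
def IsMarkovProcess {I Ω E : Type*} [Preorder I] [MeasurableSpace E]
    [MeasurableSpace Ω] (Z : I → Ω → E) (P : Measure Ω) : Prop :=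
  (∀ t, Measurable (Z t)) ∧
  ∀ f : E → ℝ, Measurable f → (∃ C : ℝ, ∀ x, |f x| ≤ C) →
    ∀ s t : I, s ≤ t →
      P[fun ω => f (Z t ω) | past Z s] =ᵐ[P]
        P[fun ω => f (Z t ω) | MeasurableSpace.comap (Z s) inferInstance]

/-- Strict stationarity of a process indexed by `[0, T]`: the finite-dimensional distributions are
invariant under every time shift that stays inside `[0, T]`. -/
def IsStationary {T : ℝ} {Ω E : Type*} [MeasurableSpace E] [MeasurableSpace Ω]
    (Z : Set.Icc (0 : ℝ) T → Ω → E) (P : Measure Ω) : Prop :=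
  ∀ (n : ℕ) (t : Fin n → Set.Icc (0 : ℝ) T) (h : ℝ)
    (ht : ∀ k, (t k : ℝ) + h ∈ Set.Icc (0 : ℝ) T),
    P.map (fun ω k => Z (t k) ω) = P.map (fun ω k => Z ⟨(t k : ℝ) + h, ht k⟩ ω)

/-- `g x t y` is a positive, jointly continuous parabolic Green function (fundamental solution) of
`∂ₜ u = ½ Δ u - V u` on `ℝᴺ × (0, ∞)`. -/
structure IsGreenFunction {N : ℕ} (V : EuclideanSpace ℝ (Fin N) → ℝ)
    (g : EuclideanSpace ℝ (Fin N) → ℝ → EuclideanSpace ℝ (Fin N) → ℝ) : Prop where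
  pos : ∀ x t y, 0 < t → 0 < g x t y
  continuousOn : ContinuousOn
    (fun p : EuclideanSpace ℝ (Fin N) × ℝ × EuclideanSpace ℝ (Fin N) => g p.1 p.2.1 p.2.2)
    {p | 0 < p.2.1}
  contDiff : ∀ t y, 0 < t → ContDiff ℝ 2 (fun x => g x t y)
  equation : ∀ x t y, 0 < t →
    HasDerivAt (fun τ => g x τ y) (1 / 2 * Δ (fun ξ => g ξ t y) x - V x * g x t y) t
  initial : ∀ f : EuclideanSpace ℝ (Fin N) → ℝ, Continuous f → HasCompactSupport f → ∀ x,
    Tendsto (fun t => ∫ y, g x t y * f y) (𝓝[>] 0) (𝓝 (f x))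

/-- The transition function `P(x, t; A, r; y, s)` attached to a Green function `g`. -/
noncomputable def bernsteinTransition {N : ℕ}
    (g : EuclideanSpace ℝ (Fin N) → ℝ → EuclideanSpace ℝ (Fin N) → ℝ)
    (x : EuclideanSpace ℝ (Fin N)) (t : ℝ) (A : Set (EuclideanSpace ℝ (Fin N))) (r : ℝ)
    (y : EuclideanSpace ℝ (Fin N)) (s : ℝ) : ℝ :=
  ∫ z in A, g x (t - r) z * g z (r - s) y / g x (t - s) y

/-- The Markovian endpoint measure `dμ(x, y) = g(x, T, y) d(ν₀ ⊗ ν₁)(x, y)`. -/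
noncomputable def markovianMeasure {N : ℕ}
    (g : EuclideanSpace ℝ (Fin N) → ℝ → EuclideanSpace ℝ (Fin N) → ℝ) (T : ℝ)
    (ν₀ ν₁ : Measure (EuclideanSpace ℝ (Fin N))) :
    Measure (EuclideanSpace ℝ (Fin N) × EuclideanSpace ℝ (Fin N)) :=
  (ν₀.prod ν₁).withDensity (fun p => ENNReal.ofReal (g p.1 T p.2))

/-- `Z` is a Bernstein process associated with the forward-backward system whose Green function
is `g`, whose initial datum (at time `0`) is the measure `φ` and whose final datum (at time `T`)
is the measure `ψ`: it is a Bernstein process, its transition function is the one given by `g`,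
and `(Z 0, Z T)` is distributed according to the Markovian measure built from `φ`, `ψ`, `g`. -/
structure IsAssociatedBernsteinProcess {N : ℕ}
    (g : EuclideanSpace ℝ (Fin N) → ℝ → EuclideanSpace ℝ (Fin N) → ℝ) {T : ℝ} (hT : 0 ≤ T)
    (φ ψ : Measure (EuclideanSpace ℝ (Fin N))) {Ω : Type*} [MeasurableSpace Ω]
    (Z : Set.Icc (0 : ℝ) T → Ω → EuclideanSpace ℝ (Fin N)) (P : Measure Ω) : Prop
    extends IsBernsteinProcess Z P where
  transition : ∀ A : Set (EuclideanSpace ℝ (Fin N)), MeasurableSet A →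
    ∀ s r t : Set.Icc (0 : ℝ) T, s < r → r < t →
      P⟦Z r ⁻¹' A | pairSigma Z s t⟧ =ᵐ[P]
        fun ω => bernsteinTransition g (Z t ω) t A r (Z s ω) s
  endpoints :
    P.map (fun ω => (Z ⟨0, Set.left_mem_Icc.mpr hT⟩ ω, Z ⟨T, Set.right_mem_Icc.mpr hT⟩ ω))
      = markovianMeasure g T φ ψ

/-- The harmonic potential `λ² |x|² / 2`. -/
noncomputable def harmonicPotential {N : ℕ} (lam : ℝ) (x : EuclideanSpace ℝ (Fin N)) : ℝ :=
  lam ^ 2 / 2 * ‖x‖ ^ 2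

/-- The `N`-dimensional Mehler kernel. -/
noncomputable def mehlerKernel {N : ℕ} (lam : ℝ) (x : EuclideanSpace ℝ (Fin N)) (t : ℝ)
    (y : EuclideanSpace ℝ (Fin N)) : ℝ :=
  (lam / (2 * Real.pi * Real.sinh (lam * t))) ^ ((N : ℝ) / 2) *
    Real.exp (-(lam * (Real.cosh (lam * t) * (‖x‖ ^ 2 + ‖y‖ ^ 2) - 2 * inner ℝ x y))
      / (2 * Real.sinh (lam * t)))

/-- The normalizing factor in front of the Dirac data. -/
noncomputable def diracWeight {N : ℕ} (lam T : ℝ) (a : EuclideanSpace ℝ (Fin N)) : ℝ :=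
  (2 * Real.pi * Real.sinh (lam * T) / lam) ^ ((N : ℝ) / 4) *
    Real.exp (lam * (Real.cosh (lam * T) / Real.sinh (lam * T)) * ‖a‖ ^ 2 / 4)

/-- The datum `m δ_b`, where `m` is the normalizing factor. -/
noncomputable def diracDatum {N : ℕ} (lam T : ℝ) (a b : EuclideanSpace ℝ (Fin N)) :
    Measure (EuclideanSpace ℝ (Fin N)) :=
  ENNReal.ofReal (diracWeight lam T a) • Measure.dirac b

/-- The mean curve `sinh(λt) / sinh(λT) · a`. -/
noncomputable def bridgeMean {N : ℕ} (lam T : ℝ) (a : EuclideanSpace ℝ (Fin N)) (t : ℝ) :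
    EuclideanSpace ℝ (Fin N) :=
  (Real.sinh (lam * t) / Real.sinh (lam * T)) • a

/-- The variance `sinh(λ(T-t)) sinh(λt) / (λ sinh(λT))`. -/
noncomputable def bridgeVar (lam T t : ℝ) : ℝ :=
  Real.sinh (lam * (T - t)) * Real.sinh (lam * t) / (lam * Real.sinh (lam * T))

end BernsteinBridge

namespace BernsteinBridge

/-! For fixed x and y, the quotient g(x,A,z) g(z,B,y) / g(x,A+B,y) is a Gaussian density in z. Its
variance depends only on A and B, and its mean is linear in x and y (`mehlerKernel_mul_div`).
Condition (ii) thus says that Z_r - M, with M a fixed linear combination of Z_s and Z_t, has a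
conditional law that does not depend on the conditioning. By (i) one may condition on the whole past
of s and future of t, so Z_r - M is independent of both (`indep_sub_of_condExp_indicator`).

The Dirac data turn (iii) into the unit mass at (0, a). With t = T the right end is the constant a,
and the centred process Y = Z - a_λ satisfies Y_r = α Y_s + ξ, where α = sinh(λ(T-r)) / sinh(λ(T-s))
and ξ is Gaussian and independent of the past of s (`forward_residual`, `residual_eq`). This gives
the Markov property. Since α is a quotient of two values of one function, Y_t / sinh(λ(T-t)) has
independent increments; its marginals are Gaussian, so it is a Gaussian process. The choice s = 0
gives the marginals, and multiplying the recursion by Y_s gives the covariance. Up to a constant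
factor the variance is sinh²(λT/2) - sinh²(λ(t-T/2)), hence the strict maximum at T/2 and, against
the variance 0 at t = 0, non-stationarity.

Existence reverses the argument. A Brownian motion, taken from an isonormal process over L²(ℝ; ℝ^N),
run at `bridgeClock` and multiplied by sinh(λ(T-t)), has the required covariance. For r between s
and t, the mean at r and the covariance of Z_r with any Z_τ outside (s,t) solve f'' = λ² f in r, so
the weights of M interpolate them exactly. Then Z_r - M is uncorrelated with past and future, hence
independent of them by joint Gaussianity (`residual_law_and_indep`), and (i) and (ii) follow by
freezing (`condExp_comp_add_of_indep`).

The Green function properties come from differentiating an exponential of a quadratic form and, at t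
→ 0, from reading the kernel as a multiple of a Gaussian density. -/

lemma sinh_add_mul_sinh_add (p q r : ℝ) :
    Real.sinh (p + q) * Real.sinh (q + r) =
      Real.sinh p * Real.sinh r + Real.sinh q * Real.sinh (p + q + r) := by
  have hq := Real.cosh_sq q
  simp only [Real.sinh_add, Real.cosh_add]
  linear_combination (Real.sinh p * Real.sinh r) * hq

lemma sinh_mul_pos {lam t : ℝ} (hlam : 0 < lam) (ht : 0 < t) : 0 < Real.sinh (lam * t) :=
  Real.sinh_pos_iff.mpr (mul_pos hlam ht)

/-! ### Products of Mehler kernels as Gaussian densities. -/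

/-- The variance at an intermediate time of the bridge with gaps `A` and `B` to both ends. -/
noncomputable def gapVar (lam A B : ℝ) : ℝ :=
  Real.sinh (lam * A) * Real.sinh (lam * B) / (lam * Real.sinh (lam * (A + B)))

lemma gapVar_pos {lam A B : ℝ} (hlam : 0 < lam) (hA : 0 < A) (hB : 0 < B) :
    0 < gapVar lam A B := by
  have h1 := sinh_mul_pos hlam hA
  have h2 := sinh_mul_pos hlam hB
  have h3 := sinh_mul_pos hlam (add_pos hA hB)
  unfold gapVar
  positivity

/-- The density of the centered isotropic Gaussian measure of variance `v`. -/
noncomputable def heatDensity {N : ℕ} (v : ℝ) (x : EuclideanSpace ℝ (Fin N)) : ℝ :=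
  (2 * Real.pi * v) ^ (-(N : ℝ) / 2) * Real.exp (-‖x‖ ^ 2 / (2 * v))

lemma mehlerKernel_pos {N : ℕ} {lam t : ℝ} (hlam : 0 < lam) (ht : 0 < t)
    (x y : EuclideanSpace ℝ (Fin N)) : 0 < mehlerKernel lam x t y := by
  have h1 := sinh_mul_pos hlam ht
  unfold mehlerKernel
  positivity

/-- Complete the square in z: the precision is λ(coth(λA) + coth(λB)), which the addition formula
turns into the inverse of `gapVar`. -/
lemma mehlerKernel_mul_div {N : ℕ} {lam A B : ℝ} (hlam : 0 < lam) (hA : 0 < A) (hB : 0 < B)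
    (x y z : EuclideanSpace ℝ (Fin N)) :
    mehlerKernel lam x A z * mehlerKernel lam z B y / mehlerKernel lam x (A + B) y =
      heatDensity (gapVar lam A B)
        (z - ((Real.sinh (lam * B) / Real.sinh (lam * (A + B))) • x +
          (Real.sinh (lam * A) / Real.sinh (lam * (A + B))) • y)) := by
  have h1 := sinh_mul_pos hlam hA
  have h2 := sinh_mul_pos hlam hB
  have h3 := sinh_mul_pos hlam (add_pos hA hB)
  have e1 : Real.sinh (lam * (A + B)) * Real.cosh (lam * A) -
      Real.cosh (lam * (A + B)) * Real.sinh (lam * A) = Real.sinh (lam * B) := by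
    rw [← Real.sinh_sub]; ring_nf
  have e2 : Real.sinh (lam * (A + B)) * Real.cosh (lam * B) -
      Real.cosh (lam * (A + B)) * Real.sinh (lam * B) = Real.sinh (lam * A) := by
    rw [← Real.sinh_sub]; ring_nf
  have e3 : Real.sinh (lam * (A + B)) = Real.sinh (lam * A) * Real.cosh (lam * B) +
      Real.cosh (lam * A) * Real.sinh (lam * B) := by
    rw [← Real.sinh_add]; ring_nf
  unfold mehlerKernel heatDensity gapVar
  set sA := Real.sinh (lam * A)
  set sB := Real.sinh (lam * B)
  set s := Real.sinh (lam * (A + B))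
  set cA := Real.cosh (lam * A)
  set cB := Real.cosh (lam * B)
  set c := Real.cosh (lam * (A + B))
  have hpi := Real.pi_pos
  have hpow : (lam / (2 * Real.pi * sA)) ^ ((N : ℝ) / 2) * (lam / (2 * Real.pi * sB)) ^ ((N : ℝ) / 2)
      = (2 * Real.pi * (sA * sB / (lam * s))) ^ (-(N : ℝ) / 2) *
        (lam / (2 * Real.pi * s)) ^ ((N : ℝ) / 2) := by
    rw [neg_div, Real.rpow_neg (by positivity), ← Real.inv_rpow (by positivity),
      ← Real.mul_rpow (by positivity) (by positivity),
      ← Real.mul_rpow (by positivity) (by positivity)]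
    congr 1
    field_simp
  rw [div_eq_iff (by positivity), mul_mul_mul_comm, hpow, mul_mul_mul_comm _ (Real.exp _), ← Real.exp_add,
    ← Real.exp_add]
  congr 2
  rw [norm_sub_sq_real, norm_add_sq_real, inner_add_right, real_inner_smul_right,
    real_inner_smul_right, real_inner_smul_right, real_inner_smul_left, norm_smul, norm_smul,
    mul_pow, mul_pow, Real.norm_eq_abs, Real.norm_eq_abs, sq_abs, sq_abs, real_inner_comm z x]
  set X := ‖x‖ ^ 2
  set Y := ‖y‖ ^ 2
  set Z := ‖z‖ ^ 2
  -- `cA` and `cB` do not occur on the right, so they are traded for `c`, `s`, `sA` and `sB`.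
  have hc1 : cA = (c * sA + sB) / s := by field_simp; linarith
  have hc2 : cB = (c * sB + sA) / s := by field_simp; linarith
  have key : cA / sA + cB / sB = s / (sA * sB) := by field_simp; linarith
  have hsplit : -(lam * (cA * (X + Z) - 2 * inner ℝ z x)) / (2 * sA) +
      -(lam * (cB * (Z + Y) - 2 * inner ℝ z y)) / (2 * sB) =
      -lam / 2 * Z * (cA / sA + cB / sB) + (-lam / 2) * (cA / sA * X + cB / sB * Y
       - 2 * inner ℝ z x / sA - 2 * inner ℝ z y / sB) := by
    field_simp; ring
  rw [hsplit, key, hc1, hc2]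
  field_simp
  ring

/-- The Mehler kernel is a multiple of a Gaussian density in its last variable. -/
lemma mehlerKernel_eq_mul_heatDensity {N : ℕ} {lam t : ℝ} (hlam : 0 < lam) (ht : 0 < t)
    (x y : EuclideanSpace ℝ (Fin N)) :
    mehlerKernel lam x t y = Real.cosh (lam * t) ^ (-(N : ℝ) / 2) *
      Real.exp (-(lam * Real.sinh (lam * t) * ‖x‖ ^ 2) / (2 * Real.cosh (lam * t))) *
      heatDensity (Real.sinh (lam * t) / (lam * Real.cosh (lam * t)))
        (y - (Real.cosh (lam * t))⁻¹ • x) := by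
  have h1 := sinh_mul_pos hlam ht
  have h2 := Real.cosh_pos (lam * t)
  have e := Real.cosh_sq (lam * t)
  unfold mehlerKernel heatDensity
  set s := Real.sinh (lam * t)
  set c := Real.cosh (lam * t)
  have hpi := Real.pi_pos
  have hpow : (lam / (2 * Real.pi * s)) ^ ((N : ℝ) / 2) =
      c ^ (-(N : ℝ) / 2) * (2 * Real.pi * (s / (lam * c))) ^ (-(N : ℝ) / 2) := by
    rw [← Real.mul_rpow (by positivity) (by positivity), neg_div, Real.rpow_neg (by positivity),
      ← Real.inv_rpow (by positivity)]
    congr 1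
    field_simp
  rw [hpow, mul_mul_mul_comm, ← Real.exp_add]
  congr 2
  rw [norm_sub_sq_real, real_inner_smul_right, norm_smul, mul_pow, Real.norm_eq_abs, sq_abs,
    real_inner_comm]
  field_simp
  linear_combination (-‖x‖ ^ 2 ) * e

lemma bridgeVar_eq_gapVar (lam T t : ℝ) : bridgeVar lam T t = gapVar lam (T - t) t := by
  unfold bridgeVar gapVar
  rw [sub_add_cancel]

/-! ### Isotropic Gaussian measures and their densities. -/

/-- The centered isotropic Gaussian measure of variance `v`. -/
noncomputable def heatMeasure (N : ℕ) (v : ℝ) : Measure (EuclideanSpace ℝ (Fin N)) :=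
  (stdGaussian (EuclideanSpace ℝ (Fin N))).map (fun x => √v • x)

instance isGaussian_heatMeasure (N : ℕ) (v : ℝ) : IsGaussian (heatMeasure N v) := by
  have : heatMeasure N v = (stdGaussian (EuclideanSpace ℝ (Fin N))).map
      (√v • ContinuousLinearMap.id ℝ (EuclideanSpace ℝ (Fin N))) := rfl
  rw [this]
  infer_instance

lemma charFun_heatMeasure {N : ℕ} {v : ℝ} (hv : 0 ≤ v) (u : EuclideanSpace ℝ (Fin N)) :
    charFun (heatMeasure N v) u = Complex.exp (-(v * ‖u‖ ^ 2) / 2) := by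
  unfold heatMeasure
  rw [charFun_map_smul, charFun_stdGaussian, norm_smul]
  congr 2
  rw [Real.norm_eq_abs, abs_of_nonneg (Real.sqrt_nonneg v)]
  push_cast
  rw [mul_pow, ← Complex.ofReal_pow, Real.sq_sqrt hv]

/-- The degenerate variance lets one statement cover all of [0, T], since the bridge is
deterministic at both ends. -/
lemma heatMeasure_zero (N : ℕ) : heatMeasure N 0 = Measure.dirac 0 := by
  simp [heatMeasure]

lemma integral_id_heatMeasure (N : ℕ) (v : ℝ) : ∫ x, x ∂heatMeasure N v = 0 := by
  unfold heatMeasure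
  rw [integral_map (by fun_prop) (by fun_prop), integral_smul, integral_id_stdGaussian, smul_zero]

lemma covariance_inner_heatMeasure {N : ℕ} {v : ℝ} (hv : 0 ≤ v)
    (x y : EuclideanSpace ℝ (Fin N)) :
    cov[fun w => inner ℝ x w, fun w => inner ℝ y w; heatMeasure N v] = v * inner ℝ x y := by
  unfold heatMeasure
  rw [covariance_map (by fun_prop) (by fun_prop) (by fun_prop)]
  have h := covarianceBilin_apply_eq_cov (μ := stdGaussian (EuclideanSpace ℝ (Fin N)))
    IsGaussian.memLp_two_id x y
  rw [covarianceBilin_stdGaussian, innerSL_apply_apply] at h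
  have h1 : ∀ z : EuclideanSpace ℝ (Fin N), (fun w => inner ℝ z w) ∘ (fun w => √v • w) =
      fun w => √v * inner ℝ z w := by
    intro z; ext w; simp [real_inner_smul_right]
  rw [h1, h1, covariance_const_mul_left, covariance_const_mul_right, ← h, ← mul_assoc,
    Real.mul_self_sqrt hv]

lemma covariance_apply_heatMeasure {N : ℕ} {v : ℝ} (hv : 0 ≤ v) (i j : Fin N) :
    cov[fun w => w i, fun w => w j; heatMeasure N v] = v * (if i = j then 1 else 0) := by
  have h := covariance_inner_heatMeasure hv (EuclideanSpace.single i (1 : ℝ))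
    (EuclideanSpace.single j (1 : ℝ))
  simpa [EuclideanSpace.inner_single_left, eq_comm] using h

/-- The characteristic function of a Gaussian vector involves only the mean and variance of its
linear forms. -/
lemma hasLaw_heatMeasure {Ω : Type*} [MeasurableSpace Ω] {P : Measure Ω} {N : ℕ} {v : ℝ}
    (hv : 0 ≤ v) {X : Ω → EuclideanSpace ℝ (Fin N)} (hX : HasGaussianLaw X P)
    (hmean : ∀ x, ∫ ω, inner ℝ x (X ω) ∂P = 0)
    (hcov : ∀ x, cov[fun ω => inner ℝ x (X ω), fun ω => inner ℝ x (X ω); P] = v * ‖x‖ ^ 2) :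
    HasLaw X (heatMeasure N v) P := by
  have := hX.isProbabilityMeasure
  refine ⟨hX.aemeasurable, ?_⟩
  have := Measure.isProbabilityMeasure_map (μ := P) hX.aemeasurable
  refine Measure.ext_of_charFun ?_
  ext u
  rw [charFun_heatMeasure hv, hX.charFun_map_eq, hmean, ← covariance_self (by fun_prop), hcov]
  congr 1
  push_cast
  ring

lemma heatDensity_nonneg {N : ℕ} {v : ℝ} (hv : 0 ≤ v) (x : EuclideanSpace ℝ (Fin N)) :
    0 ≤ heatDensity v x := by
  unfold heatDensity; positivity

lemma continuous_heatDensity {N : ℕ} (v : ℝ) :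
    Continuous (heatDensity v : EuclideanSpace ℝ (Fin N) → ℝ) := by
  unfold heatDensity; fun_prop

lemma integrable_heatDensity {N : ℕ} {v : ℝ} (hv : 0 < v) :
    Integrable (heatDensity v : EuclideanSpace ℝ (Fin N) → ℝ) := by
  have h := GaussianFourier.integrable_cexp_neg_mul_sq_norm_add (V := EuclideanSpace ℝ (Fin N))
    (b := ((1 / (2 * v) : ℝ) : ℂ)) (by simpa using hv) 0 0
  have h2 := h.norm
  simp only [zero_mul, add_zero, Complex.norm_exp] at h2
  refine (h2.const_mul ((2 * Real.pi * v) ^ (-(N : ℝ) / 2))).congr (ae_of_all _ fun x => ?_)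
  unfold heatDensity
  dsimp only
  congr 2
  rw [← Complex.ofReal_pow, ← Complex.ofReal_neg, ← Complex.ofReal_mul, Complex.ofReal_re]
  field_simp

/-- The Gaussian Fourier integral shows that both finite measures have the same characteristic
function. -/
lemma heatMeasure_eq_withDensity {N : ℕ} {v : ℝ} (hv : 0 < v) :
    heatMeasure N v = volume.withDensity (fun x => ENNReal.ofReal (heatDensity v x)) := by
  have := isFiniteMeasure_withDensity_ofReal (integrable_heatDensity (N := N) hv).2
  refine Measure.ext_of_charFun ?_
  ext u
  rw [charFun_heatMeasure hv.le, charFun_apply,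
    integral_withDensity_eq_integral_toReal_smul
      (continuous_heatDensity v).measurable.ennreal_ofReal (by simp)]
  have h := GaussianFourier.integral_cexp_neg_mul_sq_norm_add (V := EuclideanSpace ℝ (Fin N))
    (b := ((1 / (2 * v) : ℝ) : ℂ)) (by simpa using hv) Complex.I u
  have hpi := Real.pi_pos
  have e : ∀ x : EuclideanSpace ℝ (Fin N), (ENNReal.ofReal (heatDensity v x)).toReal •
      Complex.exp (inner ℝ x u * Complex.I) =
      (((2 * Real.pi * v) ^ (-(N : ℝ) / 2) : ℝ) : ℂ) *
      Complex.exp (-((1 / (2 * v) : ℝ) : ℂ) * ‖x‖ ^ 2 + Complex.I * inner ℝ u x) := by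
    intro x
    rw [ENNReal.toReal_ofReal (heatDensity_nonneg hv.le x), heatDensity, Complex.real_smul,
      Complex.ofReal_mul, Complex.ofReal_exp, mul_assoc, ← Complex.exp_add, real_inner_comm]
    congr 2
    push_cast
    field_simp
  simp_rw [e]
  rw [integral_const_mul, h, finrank_euclideanSpace_fin, ← mul_assoc]
  have e2 : ((Real.pi : ℂ) / ((1 / (2 * v) : ℝ) : ℂ)) ^ ((N : ℂ) / 2) =
      (((2 * Real.pi * v) ^ ((N : ℝ) / 2) : ℝ) : ℂ) := by
    rw [Complex.ofReal_cpow (by positivity)]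
    push_cast
    congr 1
    field_simp
  rw [e2, ← Complex.ofReal_mul, ← Real.rpow_add (by positivity), ← add_div, neg_add_cancel,
    zero_div, Real.rpow_zero, Complex.ofReal_one, one_mul]
  congr 1
  push_cast
  rw [Complex.I_sq]
  field_simp
  ring

lemma heatMeasure_real_eq {N : ℕ} {v : ℝ} (hv : 0 < v) {A : Set (EuclideanSpace ℝ (Fin N))}
    (hA : MeasurableSet A) : (heatMeasure N v).real A = ∫ x in A, heatDensity v x := by
  rw [heatMeasure_eq_withDensity hv, measureReal_def, withDensity_apply _ hA,
    ← ofReal_integral_eq_lintegral_ofReal (integrable_heatDensity hv).integrableOn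
      (ae_of_all _ fun x => heatDensity_nonneg hv.le x),
    ENNReal.toReal_ofReal (integral_nonneg fun x => heatDensity_nonneg hv.le x)]

lemma heatMeasure_real_add_preimage {N : ℕ} {v : ℝ} (hv : 0 < v)
    {A : Set (EuclideanSpace ℝ (Fin N))} (hA : MeasurableSet A) (m : EuclideanSpace ℝ (Fin N)) :
    (heatMeasure N v).real {w | w + m ∈ A} = ∫ z in A, heatDensity v (z - m) := by
  have hA' : MeasurableSet {w | w + m ∈ A} := measurable_add_const m hA
  rw [heatMeasure_real_eq hv hA', ← integral_indicator hA', ← integral_indicator hA,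
    ← integral_add_right_eq_self (A.indicator _) m]
  congr with w
  simp [Set.indicator]

lemma integral_heatMeasure {N : ℕ} {v : ℝ} (hv : 0 < v) (f : EuclideanSpace ℝ (Fin N) → ℝ) :
    ∫ x, f x ∂heatMeasure N v = ∫ x, heatDensity v x * f x := by
  rw [heatMeasure_eq_withDensity hv, integral_withDensity_eq_integral_toReal_smul
      (continuous_heatDensity v).measurable.ennreal_ofReal (by simp)]
  congr with x
  rw [ENNReal.toReal_ofReal (heatDensity_nonneg hv.le x), smul_eq_mul]

/-- This is the translate form of the transition probability required by
`indep_sub_of_condExp_indicator`. -/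
lemma bernsteinTransition_mehlerKernel {N : ℕ} {lam s r t : ℝ} (hlam : 0 < lam) (hsr : s < r)
    (hrt : r < t) (x y : EuclideanSpace ℝ (Fin N)) {A : Set (EuclideanSpace ℝ (Fin N))}
    (hA : MeasurableSet A) :
    bernsteinTransition (mehlerKernel lam) x t A r y s =
      (heatMeasure N (gapVar lam (t - r) (r - s))).real
        {w | w + ((Real.sinh (lam * (r - s)) / Real.sinh (lam * (t - s))) • x +
          (Real.sinh (lam * (t - r)) / Real.sinh (lam * (t - s))) • y) ∈ A} := by
  have h1 : 0 < t - r := by linarith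
  have h2 : 0 < r - s := by linarith
  rw [heatMeasure_real_add_preimage (gapVar_pos hlam h1 h2) hA]
  unfold bernsteinTransition
  have h := mehlerKernel_mul_div hlam h1 h2 x y
  rw [show t - r + (r - s) = t - s by ring] at h
  simp_rw [h]

/-! ### Conditional laws that are translates of a fixed law, and independence. -/

section Conditioning

variable {Ω E : Type*} {G mΩ : MeasurableSpace Ω} {P : Measure Ω} [IsProbabilityMeasure P]
  [NormedAddCommGroup E] [MeasurableSpace E] [BorelSpace E] [SecondCountableTopology E]

/-- Freezing lemma: if `ξ` is independent of `G` and `M` is `G`-measurable, conditioning a function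
of `ξ + M` on `G` integrates out `ξ`. -/
lemma condExp_comp_add_of_indep (hG : G ≤ mΩ) {ν : Measure E}
    [IsProbabilityMeasure ν] {M ξ : Ω → E} (hM : Measurable[G] M) (hξ : Measurable ξ)
    (hlaw : P.map ξ = ν) (hindep : Indep G (MeasurableSpace.comap ξ inferInstance) P)
    {f : E → ℝ} (hf : Measurable f) (hb : ∃ C : ℝ, ∀ x, |f x| ≤ C) :
    P[fun ω => f (ξ ω + M ω) | G] =ᵐ[P] fun ω => ∫ w, f (w + M ω) ∂ν := by
  obtain ⟨C, hC⟩ := hb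
  have hM' : Measurable M := hM.mono hG le_rfl
  have hint : Integrable (fun ω => f (ξ ω + M ω)) P :=
    .of_bound (hf.comp (hξ.add hM')).aestronglyMeasurable C (ae_of_all _ fun ω => hC _)
  have hh : StronglyMeasurable fun m => ∫ w, f (w + m) ∂ν := by
    have : StronglyMeasurable (Function.uncurry fun (m w : E) => f (w + m)) :=
      (hf.comp (measurable_snd.add measurable_fst)).stronglyMeasurable
    exact this.integral_prod_right
  have hhb : ∀ m, ‖∫ w, f (w + m) ∂ν‖ ≤ C := fun m => by
    simpa using norm_integral_le_of_norm_le_const (μ := ν) (f := fun w => f (w + m))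
      (ae_of_all _ fun w => hC (w + m))
  have hhm : Measurable[G] fun ω => ∫ w, f (w + M ω) ∂ν := hh.measurable.comp hM
  symm
  refine ae_eq_condExp_of_forall_setIntegral_eq hG hint (fun s _ _ => ?_) (fun s hs _ => ?_)
    hhm.stronglyMeasurable.aestronglyMeasurable
  · exact (Integrable.of_bound (hhm.mono hG le_rfl).aestronglyMeasurable C
      (ae_of_all _ fun ω => hhb _)).integrableOn
  · have hsm := hG s hs
    -- The event `s` is encoded as a real coordinate next to `M`, so that independence from `ξ`
    -- becomes a product law to which Fubini applies.
    set U : Ω → ℝ × E := fun ω => (s.indicator 1 ω, M ω) with hU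
    have hUG : Measurable[G] U :=
      (Measurable.indicator (m := G) (@measurable_const _ _ _ G 1) hs).prodMk hM
    have hUm : Measurable U := hUG.mono hG le_rfl
    have hUi : IndepFun U ξ P := (indep_of_indep_of_le_left hindep hUG.comap_le)
    have hmap := (indepFun_iff_map_prod_eq_prod_map_map hUm.aemeasurable hξ.aemeasurable).mp hUi
    rw [hlaw] at hmap
    have := Measure.isProbabilityMeasure_map (μ := P) hUm.aemeasurable
    have hFm : Measurable fun p : (ℝ × E) × E => p.1.1 * f (p.2 + p.1.2) := by fun_prop
    have hL : ∀ k : Ω → ℝ, ∫ ω in s, k ω ∂P = ∫ ω, (U ω).1 * k ω ∂P := fun k => by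
      rw [← integral_indicator hsm]
      congr with ω
      by_cases h : ω ∈ s <;> simp [hU, h]
    have h1 : ∫ ω, (U ω).1 * f (ξ ω + M ω) ∂P =
        ∫ p, p.1.1 * f (p.2 + p.1.2) ∂((P.map U).prod ν) := by
      rw [← hmap, integral_map (by fun_prop) hFm.aestronglyMeasurable]
    have hFi : Integrable (fun p : (ℝ × E) × E => p.1.1 * f (p.2 + p.1.2)) ((P.map U).prod ν) := by
      rw [← hmap, integrable_map_measure hFm.aestronglyMeasurable (by fun_prop)]
      refine Integrable.of_bound (hFm.comp (hUm.prodMk hξ)).aestronglyMeasurable C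
        (ae_of_all _ fun ω => ?_)
      have hC0 : 0 ≤ C := (abs_nonneg _).trans (hC 0)
      by_cases h : ω ∈ s
      · simpa [hU, h] using hC _
      · simpa [hU, h] using hC0
    rw [hL, hL, h1, integral_prod _ hFi,
      integral_map hUm.aemeasurable]
    · congr with ω
      rw [integral_const_mul]
    · exact hFi.integral_prod_left.aestronglyMeasurable

/-- If the conditional law of `Z` given `G` is the translate by `M` of a fixed law `ν`, then
`Z - M` is independent of `G`, with law `ν`. -/
lemma indep_sub_of_condExp_indicator (hG : G ≤ mΩ) {ν : Measure E}
    [IsProbabilityMeasure ν] {M Z : Ω → E} (hM : Measurable[G] M) (hZ : Measurable Z)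
    (hcond : ∀ A : Set E, MeasurableSet A →
      P⟦Z ⁻¹' A | G⟧ =ᵐ[P] fun ω => ν.real {w | w + M ω ∈ A}) :
    P.map (fun ω => Z ω - M ω) = ν ∧
      Indep G (MeasurableSpace.comap (fun ω => Z ω - M ω) inferInstance) P := by
  have hM' : Measurable M := hM.mono hG le_rfl
  have key : ∀ s, MeasurableSet[G] s → ∀ D : Set E, MeasurableSet D →
      P (s ∩ (fun ω => Z ω - M ω) ⁻¹' D) = P s * ν D := by
    intro s hs D hD
    set U : Ω → ℝ × E := fun ω => (s.indicator 1 ω, M ω) with hU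
    have hUG : Measurable[G] U :=
      (Measurable.indicator (m := G) (@measurable_const _ _ _ G 1) hs).prodMk hM
    have hUm : Measurable U := hUG.mono hG le_rfl
    have := Measure.isProbabilityMeasure_map (μ := P) hUm.aemeasurable
    have hshear : Measurable fun p : (ℝ × E) × E => (p.1, p.2 + p.1.2) := by fun_prop
    -- On rectangles, `hcond` identifies the joint law of `U` and `Z` with the product of the law of
    -- `U` and `ν`, sheared by the second coordinate of `U`.
    have hmap : P.map (fun ω => (U ω, Z ω)) =
        ((P.map U).prod ν).map (fun p : (ℝ × E) × E => (p.1, p.2 + p.1.2)) := by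
      have := Measure.isProbabilityMeasure_map (μ := P) (hUm.prodMk hZ).aemeasurable
      refine Measure.ext_prod fun {C A} hC hA => ?_
      rw [Measure.map_apply (hUm.prodMk hZ) (hC.prod hA), Measure.map_apply hshear (hC.prod hA),
        Measure.prod_apply (hshear (hC.prod hA))]
      have hsec : ∀ u : ℝ × E, ν (Prod.mk u ⁻¹' ((fun p : (ℝ × E) × E => (p.1, p.2 + p.1.2)) ⁻¹'
          C ×ˢ A)) = C.indicator (fun u => ν {w | w + u.2 ∈ A}) u := by
        intro u
        by_cases hu : u ∈ C
        · rw [Set.indicator_of_mem hu]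
          congr 1
          ext w; simp [hu]
        · rw [Set.indicator_of_notMem hu]
          convert measure_empty (μ := ν)
          ext w; simp [hu]
      have hνm : Measurable fun u : ℝ × E => ν {w | w + u.2 ∈ A} := by
        have : MeasurableSet {p : (ℝ × E) × E | p.2 + p.1.2 ∈ A} :=
          (show Measurable fun p : (ℝ × E) × E => p.2 + p.1.2 by fun_prop) hA
        exact measurable_measure_prodMk_left this
      simp_rw [hsec]
      rw [lintegral_indicator hC, setLIntegral_map hC hνm hUm]
      have h1 := setIntegral_condExp (m := G) (μ := P) hG
        (f := (Z ⁻¹' A).indicator fun _ => (1 : ℝ))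
        ((integrable_const 1).indicator (hZ hA)) (hUG hC)
      rw [setIntegral_congr_ae (hG _ (hUG hC)) ((hcond A hA).mono fun ω h _ => h),
        setIntegral_indicator (hZ hA), setIntegral_const, smul_eq_mul, mul_one] at h1
      have h2 : ∫⁻ ω in U ⁻¹' C, ν {w | w + (U ω).2 ∈ A} ∂P =
          ENNReal.ofReal (∫ ω in U ⁻¹' C, ν.real {w | w + M ω ∈ A} ∂P) := by
        rw [ofReal_integral_eq_lintegral_ofReal]
        · simp [hU]
        · exact (Integrable.of_bound ((hνm.comp hUm).ennreal_toReal).aestronglyMeasurable 1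
            (ae_of_all _ fun ω => by
              rw [Real.norm_of_nonneg ENNReal.toReal_nonneg]
              exact measureReal_le_one)).integrableOn
        · exact ae_of_all _ fun ω => measureReal_nonneg
      rw [h2, h1, ofReal_measureReal]
      rfl
    -- Evaluating both laws on this set recovers `s` as the event that the first coordinate of `U`
    -- is 1, and undoes the shear.
    have hset : MeasurableSet {p : (ℝ × E) × E | p.1.1 = 1 ∧ p.2 - p.1.2 ∈ D} :=
      (measurableSet_eq_fun (by fun_prop) (by fun_prop)).inter
        ((show Measurable fun p : (ℝ × E) × E => p.2 - p.1.2 by fun_prop) hD)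
    have h := congrArg (fun μ => μ {p : (ℝ × E) × E | p.1.1 = 1 ∧ p.2 - p.1.2 ∈ D}) hmap
    rw [Measure.map_apply (hUm.prodMk hZ) hset, Measure.map_apply hshear hset] at h
    have hs1 : (fun ω => (U ω, Z ω)) ⁻¹' {p : (ℝ × E) × E | p.1.1 = 1 ∧ p.2 - p.1.2 ∈ D} =
        s ∩ (fun ω => Z ω - M ω) ⁻¹' D := by
      ext ω
      by_cases hω : ω ∈ s <;> simp [hU, hω]
    have hs2 : (fun p : (ℝ × E) × E => (p.1, p.2 + p.1.2)) ⁻¹'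
        {p : (ℝ × E) × E | p.1.1 = 1 ∧ p.2 - p.1.2 ∈ D} = {u : ℝ × E | u.1 = 1} ×ˢ D := by
      ext p; simp
    have hs3 : U ⁻¹' {u : ℝ × E | u.1 = 1} = s := by
      ext ω
      by_cases hω : ω ∈ s <;> simp [hU, hω]
    rw [hs1, hs2, Measure.prod_prod, Measure.map_apply hUm
      (measurableSet_eq_fun (by fun_prop) (by fun_prop)), hs3] at h
    exact h
  have hlaw : P.map (fun ω => Z ω - M ω) = ν := by
    ext D hD
    rw [Measure.map_apply (show Measurable fun ω => Z ω - M ω from hZ.sub hM') hD]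
    simpa using key Set.univ MeasurableSet.univ D hD
  refine ⟨hlaw, ?_⟩
  rw [Indep_iff]
  rintro s _ hs ⟨D, hD, rfl⟩
  rw [key s hs D hD, ← hlaw, Measure.map_apply (show Measurable fun ω => Z ω - M ω from hZ.sub hM') hD]

end Conditioning

/-! ### Isonormal Gaussian processes on a complete probability space. -/

lemma exists_complete_iid_gaussian (ι : Type) :
    ∃ (Ω : Type) (_ : MeasurableSpace Ω) (P : Measure Ω) (ξ : ι → Ω → ℝ),
      IsProbabilityMeasure P ∧ P.IsComplete ∧ (∀ i, Measurable (ξ i)) ∧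
        (∀ i, P.map (ξ i) = gaussianReal 0 1) ∧ iIndepFun ξ P := by
  obtain ⟨Ω, mΩ, P, ξ, hm, hlaw, hind, hP⟩ := exists_iid ι (gaussianReal 0 1)
  -- The completion keeps the measure of the old events, so laws and independence carry over.
  have hm' : ∀ i, Measurable (fun ω : NullMeasurableSpace Ω P => ξ i ω) := fun i s hs =>
    (hm i hs).nullMeasurableSet
  refine ⟨NullMeasurableSpace Ω P, inferInstance, P.completion, fun i ω => ξ i ω, ⟨?_⟩,
    inferInstance, hm', fun i => ?_, ?_⟩
  · exact (Measure.completion_apply P _).trans hP.measure_univ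
  · rw [← (hlaw i).map_eq]
    ext s hs
    rw [Measure.map_apply (hm' i) hs, Measure.map_apply (hm i) hs]
    exact Measure.completion_apply P _
  · rw [iIndepFun_iff_measure_inter_preimage_eq_mul] at hind ⊢
    intro S sets hS
    refine (Measure.completion_apply P _).trans ((hind S hS).trans ?_)
    exact Finset.prod_congr rfl fun i _ => (Measure.completion_apply P _).symm

section CharFunLp

variable {Ω : Type*} [MeasurableSpace Ω] {P : Measure Ω}

lemma charFun_map_eq_integral (X : Lp ℝ 2 P) (r : ℝ) :
    charFun (P.map X) r = ∫ ω, Complex.exp (Complex.I * (r * X ω : ℝ)) ∂P := by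
  have hX : Measurable X := (Lp.stronglyMeasurable X).measurable
  rw [charFun_apply_real, integral_map hX.aemeasurable (by fun_prop)]
  congr with ω
  push_cast
  ring_nf

variable [IsProbabilityMeasure P]

lemma integral_abs_le_norm_Lp_two (X : Lp ℝ 2 P) : ∫ ω, |X ω| ∂P ≤ ‖X‖ := by
  have hX := Lp.memLp X
  have h1 : ∫ ω, |X ω| ∂P = (eLpNorm X 1 P).toReal := by
    rw [eLpNorm_one_eq_lintegral_enorm]
    exact integral_norm_eq_lintegral_enorm hX.1
  rw [h1, Lp.norm_def]
  exact ENNReal.toReal_mono hX.eLpNorm_ne_top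
    (eLpNorm_le_eLpNorm_of_exponent_le (by norm_num) hX.1)

lemma norm_exp_I_mul_ofReal_sub_le (x y : ℝ) :
    ‖Complex.exp (Complex.I * x) - Complex.exp (Complex.I * y)‖ ≤ |x - y| := by
  have : Complex.exp (Complex.I * x) - Complex.exp (Complex.I * y) =
      Complex.exp (Complex.I * y) * (Complex.exp (Complex.I * (x - y : ℝ)) - 1) := by
    rw [mul_sub, ← Complex.exp_add]
    push_cast
    ring_nf
  rw [this, norm_mul, mul_comm Complex.I (y : ℂ), Complex.norm_exp_ofReal_mul_I, one_mul]
  exact Real.norm_exp_I_mul_ofReal_sub_one_le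

/-- The characteristic function of an `L²` random variable depends continuously on it. -/
lemma continuous_charFun_map_Lp (r : ℝ) :
    Continuous fun X : Lp ℝ 2 P => charFun (P.map X) r := by
  have hint : ∀ X : Lp ℝ 2 P, Integrable (fun ω => Complex.exp (Complex.I * (r * X ω : ℝ))) P := by
    intro X
    have hX : Measurable X := (Lp.stronglyMeasurable X).measurable
    refine Integrable.of_bound (Measurable.aestronglyMeasurable (by fun_prop)) 1
      (ae_of_all _ fun ω => ?_)
    rw [mul_comm, Complex.norm_exp_ofReal_mul_I]
  have hL : LipschitzWith ⟨|r|, abs_nonneg r⟩ fun X : Lp ℝ 2 P => charFun (P.map X) r := by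
    refine LipschitzWith.of_dist_le_mul fun X Y => ?_
    rw [dist_eq_norm, dist_eq_norm, charFun_map_eq_integral, charFun_map_eq_integral,
      ← integral_sub (hint X) (hint Y)]
    have hsub : (fun ω => |X ω - Y ω|) =ᵐ[P] fun ω => |(X - Y) ω| := by
      filter_upwards [Lp.coeFn_sub X Y] with ω h
      rw [h, Pi.sub_apply]
    have hi : Integrable (fun ω => |X ω - Y ω|) P :=
      (((Lp.memLp X).sub (Lp.memLp Y)).integrable (by norm_num)).abs
    calc _ ≤ ∫ ω, |r| * |X ω - Y ω| ∂P := by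
          refine norm_integral_le_of_norm_le (hi.const_mul _) (ae_of_all _ fun ω => ?_)
          rw [← abs_mul, mul_sub]
          exact norm_exp_I_mul_ofReal_sub_le _ _
      _ = |r| * ∫ ω, |(X - Y) ω| ∂P := by rw [integral_const_mul, integral_congr_ae hsub]
      _ ≤ |r| * ‖X - Y‖ := by
          gcongr
          exact integral_abs_le_norm_Lp_two _
  exact hL.continuous

/-- This lets Gaussianity pass from finite sums to L² limits: the law is tested through
characteristic functions, which are continuous in L², as is the norm. -/
lemma isClosed_map_eq_gaussianReal :
    IsClosed {X : Lp ℝ 2 P | P.map X = gaussianReal 0 (‖X‖₊ ^ 2)} := by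
  have : {X : Lp ℝ 2 P | P.map X = gaussianReal 0 (‖X‖₊ ^ 2)} =
      ⋂ r : ℝ, {X : Lp ℝ 2 P | charFun (P.map X) r = Complex.exp (-(‖X‖ ^ 2 * r ^ 2 / 2))} := by
    ext X
    have hX : Measurable X := (Lp.stronglyMeasurable X).measurable
    have := Measure.isProbabilityMeasure_map (μ := P) hX.aemeasurable
    simp only [Set.mem_ofPred_eq, Set.mem_iInter]
    constructor
    · intro h r
      rw [h, charFun_gaussianReal]
      simp
    · intro h
      refine Measure.ext_of_charFun (funext fun r => ?_)
      rw [h, charFun_gaussianReal]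
      simp
  rw [this]
  refine isClosed_iInter fun r => isClosed_eq (continuous_charFun_map_Lp r) ?_
  fun_prop

end CharFunLp

/-- Every real Hilbert space indexes an isonormal Gaussian process on a complete probability
space. -/
lemma exists_isonormal (H : Type) [NormedAddCommGroup H] [InnerProductSpace ℝ H]
    [CompleteSpace H] :
    ∃ (Ω : Type) (_ : MeasurableSpace Ω) (P : Measure Ω) (W : H → Ω → ℝ),
      IsProbabilityMeasure P ∧ P.IsComplete ∧ (∀ h, Measurable (W h)) ∧
        IsGaussianProcess W P ∧ (∀ h, ∫ ω, W h ω ∂P = 0) ∧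
        ∀ h k, cov[W h, W k; P] = inner ℝ h k := by
  obtain ⟨w, b, -⟩ := exists_hilbertBasis ℝ H
  obtain ⟨Ω, mΩ, P, ξ, hP, hc, hξm, hξlaw, hξi⟩ := exists_complete_iid_gaussian w
  have hξL : ∀ i, HasLaw (ξ i) (gaussianReal 0 1) P := fun i => ⟨(hξm i).aemeasurable, hξlaw i⟩
  have hξg : ∀ i, HasGaussianLaw (ξ i) P := fun i => (hξL i).hasGaussianLaw
  have hξ2 : ∀ i, MemLp (ξ i) 2 P := fun i => (hξg i).memLp_two
  have hξ0 : ∀ i, ∫ ω, ξ i ω ∂P = 0 := fun i => by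
    rw [(hξL i).integral_eq, integral_id_gaussianReal]
  have hξv : ∀ i, Var[ξ i; P] = 1 := fun i => by
    rw [(hξL i).variance_eq, variance_id_gaussianReal]; rfl
  have hproc : IsGaussianProcess ξ P :=
    ⟨fun I => (hξi.precomp (g := fun i : I => (i : w)) Subtype.val_injective).hasGaussianLaw
      fun i => hξg i⟩
  set e : w → Lp ℝ 2 P := fun i => (hξ2 i).toLp with he
  have hee : ∀ i, e i =ᵐ[P] ξ i := fun i => (hξ2 i).coeFn_toLp
  have hinner : ∀ i j, inner ℝ (e i) (e j) = cov[ξ i, ξ j; P] := by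
    intro i j
    rw [L2.inner_def, covariance_eq_sub (hξ2 i) (hξ2 j), hξ0, hξ0, mul_zero, sub_zero]
    refine integral_congr_ae ?_
    filter_upwards [hee i, hee j] with ω h1 h2
    simp [h1, h2, mul_comm]
  have hon : Orthonormal ℝ e := by
    constructor
    · intro i
      have h := hinner i i
      rw [covariance_self (hξm i).aemeasurable, hξv, real_inner_self_eq_norm_sq] at h
      nlinarith [norm_nonneg (e i)]
    · intro i j hij
      rw [hinner, (hξi.indepFun hij).covariance_eq_zero (hξ2 i) (hξ2 j)]
  -- The isometry sends the Hilbert basis `b` to the orthonormal Gaussian family `e`. Each `U h` is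
  -- then an L² limit of finite Gaussian sums, and covariances are inner products.
  set U : H →ₗᵢ[ℝ] Lp ℝ 2 P :=
    hon.orthogonalFamily.linearIsometry.comp b.repr.toLinearIsometry with hU
  have hgauss : ∀ h, P.map (U h) = gaussianReal 0 (‖U h‖₊ ^ 2) := by
    intro h
    refine isClosed_map_eq_gaussianReal.mem_of_tendsto
      (hon.orthogonalFamily.hasSum_linearIsometry (b.repr h)) (Eventually.of_forall fun s => ?_)
    set c : w → ℝ := fun i => b.repr h i
    set X : Lp ℝ 2 P := ∑ i ∈ s, c i • e i with hX
    have hXs : ∑ i ∈ s, LinearIsometry.toSpanSingleton ℝ (Lp ℝ 2 P) (hon.1 i) (c i) = X := by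
      simp [hX]
    have hXe : X =ᵐ[P] fun ω => ∑ i ∈ s, c i • ξ i ω := by
      rw [hX]
      refine (Lp.coeFn_finsetSum _ _).trans ?_
      have : ∀ᵐ ω ∂P, ∀ i ∈ s, (c i • e i : Lp ℝ 2 P) ω = c i • ξ i ω := by
        rw [Finset.eventually_all]
        intro i _
        filter_upwards [Lp.coeFn_smul (c i) (e i), hee i] with ω h1 h2
        rw [h1, Pi.smul_apply, h2]
      filter_upwards [this] with ω h
      rw [Finset.sum_apply]
      exact Finset.sum_congr rfl h
    have hXg : HasGaussianLaw X P :=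
      ((hproc.smul fun i => c i).hasGaussianLaw_fun_sum (I := s)).congr hXe.symm
    have hX0 : ∫ ω, X ω ∂P = 0 := by
      rw [integral_congr_ae hXe, integral_finsetSum]
      · simp [integral_const_mul, hξ0]
      · exact fun i _ => (hξg i).integrable.smul (c i)
    have hXv : Var[X; P] = ‖X‖ ^ 2 := by
      rw [variance_of_integral_eq_zero hXg.aemeasurable hX0, ← real_inner_self_eq_norm_sq,
        L2.inner_def]
      congr with ω
      simp
    change P.map (∑ i ∈ s, LinearIsometry.toSpanSingleton ℝ (Lp ℝ 2 P) (hon.1 i) (c i) : Lp ℝ 2 P) =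
      gaussianReal 0 (‖∑ i ∈ s, LinearIsometry.toSpanSingleton ℝ (Lp ℝ 2 P) (hon.1 i) (c i)‖₊ ^ 2)
    rw [hXs, hXg.map_eq_gaussianReal, hX0, hXv]
    congr 1
    ext
    simp
  have hm : ∀ h, Measurable (U h) := fun h => (Lp.stronglyMeasurable (U h)).measurable
  have hg : ∀ h, HasGaussianLaw (U h) P := fun h => ⟨by rw [hgauss]; infer_instance⟩
  have h0 : ∀ h, ∫ ω, U h ω ∂P = 0 := fun h => by
    rw [(HasLaw.mk (hm h).aemeasurable (hgauss h)).integral_eq, integral_id_gaussianReal]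
  refine ⟨Ω, mΩ, P, fun h => U h, hP, hc, hm, ⟨fun I => ⟨?_⟩⟩, h0, fun h k => ?_⟩
  · classical
    refine isGaussian_of_isGaussian_map fun L => ?_
    rw [Measure.map_map L.continuous.measurable (by fun_prop)]
    -- Joint Gaussianity comes from linearity: a linear form in finitely many `U h` is almost surely
    -- `U` of a single vector.
    have : L ∘ (fun ω => I.restrict fun h => U h ω) =ᵐ[P]
        U (∑ h : I, L (Pi.single h 1) • (h : H)) := by
      rw [map_sum]
      have h1 : ∀ᵐ ω ∂P, ∀ h ∈ (Finset.univ : Finset I),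
          (U (L (Pi.single h 1) • (h : H))) ω = L (Pi.single h 1) * U h ω := by
        rw [Finset.eventually_all]
        intro h _
        rw [map_smul]
        filter_upwards [Lp.coeFn_smul (L (Pi.single h 1)) (U h)] with ω h1
        rw [h1]; rfl
      filter_upwards [h1, Lp.coeFn_finsetSum Finset.univ
        fun h : I => U (L (Pi.single h 1) • (h : H))] with ω h1 h2
      rw [h2, Finset.sum_apply, Finset.sum_congr rfl h1, Function.comp_apply,
        ← L.coe_coe, L.toLinearMap.pi_apply_eq_sum_univ]
      refine Finset.sum_congr rfl fun h _ => ?_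
      rw [smul_eq_mul, mul_comm]
      congr 2
      ext j
      simp [Pi.single_apply, eq_comm]
    rw [Measure.map_congr this]
    exact (hg _).isGaussian_map
  · rw [covariance_eq_sub (hg h).memLp_two (hg k).memLp_two, h0, h0, mul_zero, sub_zero,
      ← U.inner_map_map, L2.inner_def]
    congr with ω
    exact mul_comm _ _

/-! ### Interpolation of the mean and covariance between two times. -/

/-- The covariance function of the bridge. -/
noncomputable def bridgeCov (lam T s t : ℝ) : ℝ :=
  Real.sinh (lam * (T - max s t)) * Real.sinh (lam * min s t) / (lam * Real.sinh (lam * T))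

lemma bridgeCov_comm (lam T s t : ℝ) : bridgeCov lam T s t = bridgeCov lam T t s := by
  unfold bridgeCov; rw [max_comm, min_comm]

lemma bridgeCov_of_le {lam T s t : ℝ} (h : s ≤ t) : bridgeCov lam T s t =
    Real.sinh (lam * (T - t)) * Real.sinh (lam * s) / (lam * Real.sinh (lam * T)) := by
  unfold bridgeCov; rw [max_eq_right h, min_eq_left h]

lemma bridgeCov_self (lam T t : ℝ) : bridgeCov lam T t t = bridgeVar lam T t := by
  unfold bridgeCov bridgeVar; rw [max_self, min_self]

lemma bridgeVar_nonneg {lam T t : ℝ} (hlam : 0 < lam) (hT : 0 < T) (h0 : 0 ≤ t) (h1 : t ≤ T) :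
    0 ≤ bridgeVar lam T t := by
  have hs := sinh_mul_pos hlam hT
  have h2 : 0 ≤ Real.sinh (lam * (T - t)) :=
    Real.sinh_nonneg_iff.mpr (mul_nonneg hlam.le (by linarith))
  have h3 : 0 ≤ Real.sinh (lam * t) := Real.sinh_nonneg_iff.mpr (mul_nonneg hlam.le h0)
  unfold bridgeVar; positivity

/-- The hyperbolic form of Ptolemy's identity for the four times s, r, t, u. -/
lemma sinh_interp (lam s r t u : ℝ) :
    Real.sinh (lam * (t - s)) * Real.sinh (lam * (u - r)) =
      Real.sinh (lam * (r - s)) * Real.sinh (lam * (u - t)) +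
        Real.sinh (lam * (t - r)) * Real.sinh (lam * (u - s)) := by
  have h := sinh_add_mul_sinh_add (lam * (r - s)) (lam * (t - r)) (lam * (u - t))
  ring_nf at h ⊢
  exact h

lemma sinh_interp_zero (lam s r t : ℝ) :
    Real.sinh (lam * (t - s)) * Real.sinh (lam * r) =
      Real.sinh (lam * (r - s)) * Real.sinh (lam * t) +
        Real.sinh (lam * (t - r)) * Real.sinh (lam * s) := by
  have h := sinh_interp lam s r t 0
  simp only [zero_sub, mul_neg, Real.sinh_neg] at h
  linarith

/-- The weight of the right end point in the interpolation between times `s` and `t`. -/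
noncomputable def rightWeight (lam s r t : ℝ) : ℝ :=
  Real.sinh (lam * (r - s)) / Real.sinh (lam * (t - s))

/-- The weight of the left end point in the interpolation between times `s` and `t`. -/
noncomputable def leftWeight (lam s r t : ℝ) : ℝ :=
  Real.sinh (lam * (t - r)) / Real.sinh (lam * (t - s))

/-- As functions of r, the two weights are the solutions of f'' = λ² f with values (0, 1) and (1, 0)
at (s, t). Any solution, here sinh(λr), is therefore recovered from its values at s and t. -/
lemma sinh_eq_weights {lam s t : ℝ} (hlam : 0 < lam) (hst : s < t) (r : ℝ) :
    Real.sinh (lam * r) = rightWeight lam s r t * Real.sinh (lam * t) +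
      leftWeight lam s r t * Real.sinh (lam * s) := by
  have h := sinh_interp_zero lam s r t
  have hp := sinh_mul_pos hlam (sub_pos.mpr hst)
  unfold rightWeight leftWeight
  field_simp
  linarith

lemma sinh_sub_eq_weights {lam s t : ℝ} (hlam : 0 < lam) (hst : s < t) (r u : ℝ) :
    Real.sinh (lam * (u - r)) = rightWeight lam s r t * Real.sinh (lam * (u - t)) +
      leftWeight lam s r t * Real.sinh (lam * (u - s)) := by
  have h := sinh_interp lam s r t u
  have hp := sinh_mul_pos hlam (sub_pos.mpr hst)
  unfold rightWeight leftWeight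
  field_simp
  linarith

lemma bridgeMean_eq_weights {N : ℕ} {lam T s t : ℝ} (hlam : 0 < lam) (hst : s < t)
    (a : EuclideanSpace ℝ (Fin N)) (r : ℝ) :
    bridgeMean lam T a r = rightWeight lam s r t • bridgeMean lam T a t +
      leftWeight lam s r t • bridgeMean lam T a s := by
  unfold bridgeMean
  rw [smul_smul, smul_smul, ← add_smul, sinh_eq_weights hlam hst r]
  congr 1
  ring

/-- For τ outside (s, t) the maximum and minimum do not switch while r runs through [s, t], so the
covariance solves f'' = λ² f there. This makes the residual at r uncorrelated with Z_τ. -/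
lemma bridgeCov_eq_weights {lam T s r t τ : ℝ} (hlam : 0 < lam) (hsr : s < r) (hrt : r < t)
    (hτ : τ ≤ s ∨ t ≤ τ) :
    bridgeCov lam T r τ = rightWeight lam s r t * bridgeCov lam T t τ +
      leftWeight lam s r t * bridgeCov lam T s τ := by
  have hst := hsr.trans hrt
  rcases hτ with h | h
  · rw [bridgeCov_comm _ _ r, bridgeCov_comm _ _ t, bridgeCov_comm _ _ s, bridgeCov_of_le h,
      bridgeCov_of_le (h.trans hsr.le), bridgeCov_of_le (h.trans hst.le),
      sinh_sub_eq_weights hlam hst r T]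
    ring
  · rw [bridgeCov_of_le h, bridgeCov_of_le (hrt.le.trans h), bridgeCov_of_le (hst.le.trans h),
      sinh_eq_weights hlam hst r]
    ring

/-- The left side is the covariance of the residual with Z_r. It equals the variance of the
residual, because the residual is orthogonal to Z_s and Z_t. -/
lemma bridgeVar_sub_weights {lam T s r t : ℝ} (hlam : 0 < lam) (hT : 0 < T) (hsr : s < r)
    (hrt : r < t) :
    bridgeCov lam T r r - (rightWeight lam s r t * bridgeCov lam T t r +
      leftWeight lam s r t * bridgeCov lam T s r) = gapVar lam (t - r) (r - s) := by
  have hst := hsr.trans hrt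
  have hp := sinh_mul_pos hlam (sub_pos.mpr hst)
  have hTp := sinh_mul_pos hlam hT
  have h1 := sinh_sub_eq_weights hlam hst r T
  have h2 := sinh_interp lam 0 s r T
  simp only [sub_zero] at h2
  rw [bridgeCov_comm _ _ t, bridgeCov_of_le hsr.le, bridgeCov_of_le hrt.le,
    bridgeCov_of_le le_rfl]
  unfold gapVar
  rw [show t - r + (r - s) = t - s by ring]
  have h3 : leftWeight lam s r t = Real.sinh (lam * (t - r)) / Real.sinh (lam * (t - s)) := rfl
  have e : Real.sinh (lam * (T - r)) * Real.sinh (lam * r) / (lam * Real.sinh (lam * T)) -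
      (rightWeight lam s r t * (Real.sinh (lam * (T - t)) * Real.sinh (lam * r) /
        (lam * Real.sinh (lam * T))) + leftWeight lam s r t *
        (Real.sinh (lam * (T - r)) * Real.sinh (lam * s) / (lam * Real.sinh (lam * T)))) =
      leftWeight lam s r t * (Real.sinh (lam * r) * Real.sinh (lam * (T - s)) -
        Real.sinh (lam * (T - r)) * Real.sinh (lam * s)) / (lam * Real.sinh (lam * T)) := by
    field_simp
    linear_combination Real.sinh (lam * r) * h1
  rw [e, h2, h3]
  field_simp
  ring

/-! ### The endpoint measure. -/

lemma diracWeight_mul_self_mul_mehlerKernel {N : ℕ} {lam T : ℝ} (hlam : 0 < lam) (hT : 0 < T)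
    (a : EuclideanSpace ℝ (Fin N)) :
    diracWeight lam T a * diracWeight lam T a * mehlerKernel lam 0 T a = 1 := by
  have h := sinh_mul_pos hlam hT
  have hpi := Real.pi_pos
  unfold diracWeight mehlerKernel
  set S := Real.sinh (lam * T)
  rw [mul_mul_mul_comm ((2 * Real.pi * S / lam) ^ ((N : ℝ) / 4)),
    ← Real.rpow_add (by positivity), mul_mul_mul_comm, ← Real.exp_add, ← Real.exp_add, show (N : ℝ) / 4 + N / 4 = N / 2 by ring,
    ← Real.mul_rpow (by positivity) (by positivity)]
  have e1 : 2 * Real.pi * S / lam * (lam / (2 * Real.pi * S)) = 1 := by field_simp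
  rw [e1, Real.one_rpow, one_mul, Real.exp_eq_one_iff, norm_zero, inner_zero_left]
  field_simp
  ring

lemma markovianMeasure_diracDatum {N : ℕ} {lam T : ℝ} (hlam : 0 < lam) (hT : 0 < T)
    (a : EuclideanSpace ℝ (Fin N)) :
    markovianMeasure (mehlerKernel lam) T (diracDatum lam T a 0) (diracDatum lam T a a) =
      Measure.dirac ((0 : EuclideanSpace ℝ (Fin N)), a) := by
  have hw : 0 ≤ diracWeight lam T a := by
    have h := sinh_mul_pos hlam hT
    unfold diracWeight; positivity
  unfold markovianMeasure diracDatum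
  rw [Measure.prod_smul_left, Measure.prod_smul_right, Measure.dirac_prod_dirac, smul_smul,
    withDensity_smul_measure]
  rw [dirac_withDensity, smul_smul, ← ENNReal.ofReal_mul hw, ← ENNReal.ofReal_mul (by positivity),
    diracWeight_mul_self_mul_mehlerKernel hlam hT, ENNReal.ofReal_one, one_smul]

/-! ### Past, future and pair σ-algebras. -/

section SigmaAlgebras

variable {I Ω E : Type*} [MeasurableSpace E]

lemma measurable_pairSigma_comp {F : Type*} [MeasurableSpace F] (Z : I → Ω → E) (s t : I)
    {f : E × E → F} (hf : Measurable f) : Measurable[pairSigma Z s t] fun ω => f (Z s ω, Z t ω) :=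
  hf.comp (comap_measurable fun ω => (Z s ω, Z t ω))

variable [Preorder I]

lemma measurable_past (Z : I → Ω → E) {τ s : I} (h : τ ≤ s) : Measurable[past Z s] (Z τ) :=
  (comap_measurable (Z τ)).mono (le_iSup₂_of_le τ h le_rfl) le_rfl

lemma measurable_future (Z : I → Ω → E) {t τ : I} (h : t ≤ τ) : Measurable[future Z t] (Z τ) :=
  (comap_measurable (Z τ)).mono (le_iSup₂_of_le τ h le_rfl) le_rfl

lemma past_le [mΩ : MeasurableSpace Ω] {Z : I → Ω → E} (hZ : ∀ t, Measurable (Z t)) (s : I) :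
    past Z s ≤ mΩ :=
  iSup₂_le fun τ _ => (hZ τ).comap_le

lemma future_le [mΩ : MeasurableSpace Ω] {Z : I → Ω → E} (hZ : ∀ t, Measurable (Z t)) (s : I) :
    future Z s ≤ mΩ :=
  iSup₂_le fun τ _ => (hZ τ).comap_le

lemma past_mono (Z : I → Ω → E) {s t : I} (h : s ≤ t) : past Z s ≤ past Z t :=
  iSup₂_le fun _ hτ => (measurable_past Z (hτ.trans h)).comap_le

lemma pairSigma_le_past_sup_future (Z : I → Ω → E) (s t : I) :
    pairSigma Z s t ≤ past Z s ⊔ future Z t :=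
  Measurable.comap_le (((measurable_past Z le_rfl).mono le_sup_left le_rfl).prodMk
    ((measurable_future Z le_rfl).mono le_sup_right le_rfl))

lemma past_sup_future_le_comap (Z : I → Ω → E) (s t : I) :
    past Z s ⊔ future Z t ≤
      MeasurableSpace.comap (fun ω (τ : {τ // τ ≤ s ∨ t ≤ τ}) => Z τ ω) inferInstance := by
  have h : ∀ τ : {τ // τ ≤ s ∨ t ≤ τ}, MeasurableSpace.comap (Z τ) inferInstance ≤
      MeasurableSpace.comap (fun ω (τ : {τ // τ ≤ s ∨ t ≤ τ}) => Z τ ω) inferInstance := fun τ =>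
    ((measurable_pi_apply τ).comp
      (comap_measurable fun ω (τ : {τ // τ ≤ s ∨ t ≤ τ}) => Z τ ω)).comap_le
  exact sup_le (iSup₂_le fun τ hτ => h ⟨τ, Or.inl hτ⟩) (iSup₂_le fun τ hτ => h ⟨τ, Or.inr hτ⟩)

end SigmaAlgebras

/-! ### A Gaussian process with the bridge mean and covariance is an associated Bernstein process.
-/

section Gaussian

variable {N : ℕ} {lam T : ℝ} {Ω : Type*} {mΩ : MeasurableSpace Ω} {P : Measure Ω}
  {Z : Set.Icc (0 : ℝ) T → Ω → EuclideanSpace ℝ (Fin N)} {a : EuclideanSpace ℝ (Fin N)}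

/-- A Gaussian process with the mean and covariance of the bridge: the residual at an intermediate
time has the law of the transition function and is independent of what happens outside. -/
lemma residual_law_and_indep (hlam : 0 < lam) (hT : 0 < T) (hZ : ∀ t, Measurable (Z t))
    (hg : IsGaussianProcess Z P) (hmean : ∀ t, ∫ ω, Z t ω ∂P = bridgeMean lam T a t)
    (hcov : ∀ s t x y, cov[fun ω => inner ℝ x (Z s ω), fun ω => inner ℝ y (Z t ω); P] =
      bridgeCov lam T s t * inner ℝ x y)
    {s r t : Set.Icc (0 : ℝ) T} (hsr : s < r) (hrt : r < t) :
    HasLaw (fun ω => Z r ω - (rightWeight lam s r t • Z t ω + leftWeight lam s r t • Z s ω))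
      (heatMeasure N (gapVar lam (t - r) (r - s))) P ∧
    Indep (past Z s ⊔ future Z t) (MeasurableSpace.comap (fun ω => Z r ω -
      (rightWeight lam s r t • Z t ω + leftWeight lam s r t • Z s ω)) inferInstance) P := by
  have hP := hg.isProbabilityMeasure
  have hsr' : (s : ℝ) < r := hsr
  have hrt' : (r : ℝ) < t := hrt
  set α := leftWeight lam s r t with hα
  set β := rightWeight lam s r t with hβ
  set ξ : Ω → EuclideanSpace ℝ (Fin N) := fun ω => Z r ω - (β • Z t ω + α • Z s ω) with hξ
  have hξm : Measurable ξ := by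
    have := hZ r; have := hZ s; have := hZ t
    fun_prop
  have hint : ∀ t, Integrable (Z t) P := fun t => (hg.hasGaussianLaw_eval t).integrable
  have h2 : ∀ x t, MemLp (fun ω => inner ℝ x (Z t ω)) 2 P := fun x t =>
    (hg.hasGaussianLaw_eval t).memLp_two.const_inner x
  have h3 : ∀ x, MemLp ((fun ω => β * inner ℝ x (Z t ω)) + fun ω => α * inner ℝ x (Z s ω)) 2 P :=
    fun x =>
    ((h2 x t).const_mul β).add ((h2 x s).const_mul α)
  have hint3 : Integrable (fun ω => β • Z t ω + α • Z s ω) P :=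
    ((hint t).smul β).add ((hint s).smul α)
  have hL : ∀ I : Finset (Set.Icc (0 : ℝ) T), ∀ hr : r ∈ I, ∀ hs : s ∈ I, ∀ ht : t ∈ I,
      ∃ L : (I → EuclideanSpace ℝ (Fin N)) →L[ℝ] EuclideanSpace ℝ (Fin N),
        ∀ ω, ξ ω = L (I.restrict fun t => Z t ω) := fun I hr hs ht =>
    ⟨.proj ⟨r, hr⟩ - (β • .proj ⟨t, ht⟩ + α • .proj ⟨s, hs⟩), fun ω => by simp [hξ]⟩
  -- The residual is put in one Gaussian family with all outside states, so that vanishing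
  -- covariances yield independence.
  have hsum : IsGaussianProcess (Sum.elim (fun _ : Unit => ξ)
      (fun τ : {τ // τ ≤ s ∨ t ≤ τ} => Z τ)) P := by
    classical
    refine hg.of_isGaussianProcess ?_
    rintro (_ | τ)
    · exact ⟨{r, s, t}, hL _ (by simp) (by simp) (by simp)⟩
    · exact ⟨{(τ : Set.Icc (0 : ℝ) T)}, .proj ⟨τ, by simp⟩, fun ω => by simp⟩
  have hξg : HasGaussianLaw ξ P := hsum.hasGaussianLaw_eval (Sum.inl ())
  have hξ2 : ∀ x, MemLp (fun ω => inner ℝ x (ξ ω)) 2 P := fun x => hξg.memLp_two.const_inner x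
  have hcovξ : ∀ τ x y, cov[fun ω => inner ℝ x (ξ ω), fun ω => inner ℝ y (Z τ ω); P] =
      (bridgeCov lam T r τ - (β * bridgeCov lam T t τ + α * bridgeCov lam T s τ)) *
        inner ℝ x y := by
    intro τ x y
    have e : (fun ω => inner ℝ x (ξ ω)) = (fun ω => inner ℝ x (Z r ω)) -
        ((fun ω => β * inner ℝ x (Z t ω)) + fun ω => α * inner ℝ x (Z s ω)) := by
      ext ω; simp [hξ, inner_sub_right, inner_add_right, real_inner_smul_right]
    rw [e, covariance_sub_left (h2 x r) (h3 x) (h2 y τ), covariance_add_left ((h2 x t).const_mul β) ((h2 x s).const_mul α) (h2 y τ),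
      covariance_const_mul_left, covariance_const_mul_left, hcov, hcov, hcov]
    ring
  have hcov0 : ∀ τ : Set.Icc (0 : ℝ) T, τ ≤ s ∨ t ≤ τ → ∀ x y,
      cov[fun ω => inner ℝ x (ξ ω), fun ω => inner ℝ y (Z τ ω); P] = 0 := by
    intro τ hτ x y
    rw [hcovξ, bridgeCov_eq_weights hlam hsr' hrt' (τ := τ) hτ, sub_self, zero_mul]
  refine ⟨hasLaw_heatMeasure (gapVar_pos hlam (sub_pos.mpr hrt') (sub_pos.mpr hsr')).le hξg
    (fun x => ?_) (fun x => ?_), ?_⟩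
  · rw [integral_inner hξg.integrable, integral_sub (hint r) hint3]
    rw [integral_add (f := fun ω => β • Z t ω) (g := fun ω => α • Z s ω) ((hint t).smul β)
      ((hint s).smul α), integral_smul,
      integral_smul, hmean, hmean, hmean, bridgeMean_eq_weights hlam (hsr'.trans hrt') a r, sub_self, inner_zero_right]
  · have e : (fun ω => inner ℝ x (ξ ω)) = (fun ω => inner ℝ x (Z r ω)) -
        ((fun ω => β * inner ℝ x (Z t ω)) + fun ω => α * inner ℝ x (Z s ω)) := by
      ext ω; simp [hξ, inner_sub_right, inner_add_right, real_inner_smul_right]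
    -- Only one of the two factors is expanded: the terms at `s` and `t` vanish by `hcov0`, leaving
    -- the covariance with Z_r.
    nth_rw 2 [e]
    rw [covariance_sub_right (hξ2 x) (h2 x r) (h3 x),
      covariance_add_right (hξ2 x) ((h2 x t).const_mul β) ((h2 x s).const_mul α),
      covariance_const_mul_right, covariance_const_mul_right, hcov0 t (Or.inr le_rfl),
      hcov0 s (Or.inl le_rfl), hcovξ, bridgeVar_sub_weights hlam hT hsr' hrt',
      real_inner_self_eq_norm_sq]
    ring
  · have hi := hsum.indepFun_of_covariance_inner (fun _ => hξm.aemeasurable)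
      (fun τ => (hZ τ).aemeasurable) (fun _ τ x y => hcov0 τ τ.2 x y)
    have hi' : IndepFun ξ (fun ω (τ : {τ // τ ≤ s ∨ t ≤ τ}) => Z τ ω) P :=
      hi.comp (measurable_pi_apply ()) measurable_id
    exact indep_of_indep_of_le_left hi'.symm (past_sup_future_le_comap Z s t)

lemma hasLaw_sub_bridgeMean (hlam : 0 < lam) (hT : 0 < T)
    (hg : IsGaussianProcess Z P) (hmean : ∀ t, ∫ ω, Z t ω ∂P = bridgeMean lam T a t)
    (hcov : ∀ s t x y, cov[fun ω => inner ℝ x (Z s ω), fun ω => inner ℝ y (Z t ω); P] =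
      bridgeCov lam T s t * inner ℝ x y) (t : Set.Icc (0 : ℝ) T) :
    HasLaw (fun ω => Z t ω - bridgeMean lam T a t) (heatMeasure N (bridgeVar lam T t)) P := by
  have hP := hg.isProbabilityMeasure
  have hgt := hg.hasGaussianLaw_eval t
  refine hasLaw_heatMeasure (bridgeVar_nonneg hlam hT t.2.1 t.2.2) ?_ (fun x => ?_) (fun x => ?_)
  · have := hgt.isGaussian_map
    have h := AEMeasurable.map_map_of_aemeasurable
      (g := fun z => z - bridgeMean lam T a t) (by fun_prop) hgt.aemeasurable
    rw [Function.comp_def] at h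
    exact ⟨by rw [← h]; infer_instance⟩
  · have hs : Integrable (fun ω => Z t ω - bridgeMean lam T a t) P :=
      hgt.integrable.sub (integrable_const _)
    rw [integral_inner hs, integral_sub hgt.integrable (integrable_const _), hmean]
    simp
  · simp_rw [inner_sub_right]
    have hi : Integrable (fun ω => inner ℝ x (Z t ω)) P := hgt.integrable.const_inner x
    rw [covariance_sub_const_left hi, covariance_sub_const_right hi, hcov, bridgeCov_self,
      real_inner_self_eq_norm_sq]

/-- The answer is the same for every σ-algebra between `pairSigma` and past ⊔ future; comparing the
two extremes is the reciprocal property. -/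
lemma condExp_comp_of_isGaussianProcess {G mΩ : MeasurableSpace Ω} {P : Measure Ω}
    (hlam : 0 < lam) (hT : 0 < T)
    (hZ : ∀ t, Measurable (Z t)) (hg : IsGaussianProcess Z P)
    (hmean : ∀ t, ∫ ω, Z t ω ∂P = bridgeMean lam T a t)
    (hcov : ∀ s t x y, cov[fun ω => inner ℝ x (Z s ω), fun ω => inner ℝ y (Z t ω); P] =
      bridgeCov lam T s t * inner ℝ x y)
    {s r t : Set.Icc (0 : ℝ) T} (hsr : s < r) (hrt : r < t) (hpG : pairSigma Z s t ≤ G)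
    (hG : G ≤ past Z s ⊔ future Z t) {f : EuclideanSpace ℝ (Fin N) → ℝ} (hf : Measurable f)
    (hb : ∃ C : ℝ, ∀ x, |f x| ≤ C) :
    P[fun ω => f (Z r ω) | G] =ᵐ[P] fun ω =>
      ∫ w, f (w + (rightWeight lam s r t • Z t ω + leftWeight lam s r t • Z s ω))
        ∂heatMeasure N (gapVar lam (t - r) (r - s)) := by
  have hP := hg.isProbabilityMeasure
  obtain ⟨hlaw, hind⟩ := residual_law_and_indep hlam hT hZ hg hmean hcov hsr hrt
  have hGΩ := hG.trans (sup_le (past_le hZ s) (future_le hZ t))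
  have hM : Measurable[G] fun ω => rightWeight lam s r t • Z t ω +
      leftWeight lam s r t • Z s ω :=
    (measurable_pairSigma_comp Z s t (f := fun p => rightWeight lam s r t • p.2 +
      leftWeight lam s r t • p.1) (by fun_prop)).mono hpG le_rfl
  have hξ : Measurable fun ω => Z r ω - (rightWeight lam s r t • Z t ω +
      leftWeight lam s r t • Z s ω) := (hZ r).sub (hM.mono hGΩ le_rfl)
  have h := condExp_comp_add_of_indep hGΩ hM hξ hlaw.map_eq
    (indep_of_indep_of_le_left hind hG) hf hb
  simp only [sub_add_cancel] at h
  exact h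

/-- A Gaussian process with the mean and covariance of the bridge is a Bernstein process
associated with the Mehler kernel and the Dirac data. -/
lemma isAssociatedBernsteinProcess_of_isGaussianProcess (hlam : 0 < lam) (hT : 0 < T)
    (hZ : ∀ t, Measurable (Z t)) (hg : IsGaussianProcess Z P)
    (hmean : ∀ t, ∫ ω, Z t ω ∂P = bridgeMean lam T a t)
    (hcov : ∀ s t x y, cov[fun ω => inner ℝ x (Z s ω), fun ω => inner ℝ y (Z t ω); P] =
      bridgeCov lam T s t * inner ℝ x y) :
    IsAssociatedBernsteinProcess (mehlerKernel lam) hT.le (diracDatum lam T a 0)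
      (diracDatum lam T a a) Z P := by
  have hP := hg.isProbabilityMeasure
  have hcond := fun s r t hsr hrt G hpG hG f hf hb =>
    condExp_comp_of_isGaussianProcess (G := G) (s := s) (r := r) (t := t) (f := f) hlam hT hZ hg
      hmean hcov hsr hrt hpG hG hf hb
  refine { measurable := hZ, reciprocal := ?_, transition := ?_, endpoints := ?_ }
  · intro f hf hb s r t hsr hrt
    exact (hcond s r t hsr hrt _ (pairSigma_le_past_sup_future Z s t) le_rfl f hf hb).trans
      (hcond s r t hsr hrt _ le_rfl (pairSigma_le_past_sup_future Z s t) f hf hb).symm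
  · intro A hA s r t hsr hrt
    have h := hcond s r t hsr hrt _ le_rfl (pairSigma_le_past_sup_future Z s t)
      (A.indicator fun _ => 1) (measurable_const.indicator hA)
      ⟨1, fun x => by by_cases h : x ∈ A <;> simp [h]⟩
    refine Filter.EventuallyEq.trans (Filter.EventuallyEq.of_eq rfl) (h.trans ?_)
    refine ae_of_all _ fun ω => ?_
    dsimp only
    rw [bernsteinTransition_mehlerKernel hlam hsr hrt _ _ hA]
    set m := rightWeight lam s r t • Z t ω + leftWeight lam s r t • Z s ω with hm
    have hA' : MeasurableSet {w | w + m ∈ A} := measurable_add_const m hA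
    change ∫ w, {w | w + m ∈ A}.indicator (fun _ => (1 : ℝ)) w ∂_ = _
    rw [integral_indicator hA', setIntegral_const, smul_eq_mul, mul_one]
    rfl
  · rw [markovianMeasure_diracDatum hlam hT]
    have h0 := hasLaw_sub_bridgeMean hlam hT hg hmean hcov ⟨0, Set.left_mem_Icc.mpr hT.le⟩
    have h1 := hasLaw_sub_bridgeMean hlam hT hg hmean hcov ⟨T, Set.right_mem_Icc.mpr hT.le⟩
    have e0 : bridgeVar lam T 0 = 0 := by simp [bridgeVar]
    have e1 : bridgeVar lam T T = 0 := by simp [bridgeVar]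
    have m0 : bridgeMean lam T a 0 = 0 := by simp [bridgeMean]
    have m1 : bridgeMean lam T a T = a := by
      simp [bridgeMean, (sinh_mul_pos hlam hT).ne']
    dsimp only at h0 h1
    rw [e0, heatMeasure_zero] at h0
    rw [e1, heatMeasure_zero] at h1
    have h := hasLaw_dirac_of_ae_eq (P := P) (m𝓧 := inferInstance)
      (X := fun ω => (Z ⟨0, Set.left_mem_Icc.mpr hT.le⟩ ω, Z ⟨T, Set.right_mem_Icc.mpr hT.le⟩ ω))
      (x := ((0 : EuclideanSpace ℝ (Fin N)), a)) (by
        filter_upwards [h0.ae_eq_of_dirac, h1.ae_eq_of_dirac] with ω k0 k1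
        rw [m0, sub_zero] at k0
        rw [m1, sub_eq_zero] at k1
        rw [k0, k1])
    exact h.map_eq

end Gaussian

/-! ### Existence by a time-changed Brownian motion. -/

lemma isGaussianProcess_const_add {I Ω E : Type*} [MeasurableSpace Ω] {P : Measure Ω}
    [NormedAddCommGroup E] [NormedSpace ℝ E] [MeasurableSpace E] [BorelSpace E]
    [SecondCountableTopology E] {X : I → Ω → E} (hX : IsGaussianProcess X P) (m : I → E) :
    IsGaussianProcess (fun t ω => m t + X t ω) P := by
  refine ⟨fun J => ⟨?_⟩⟩
  have hJ := hX.hasGaussianLaw J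
  have := hJ.isGaussian_map
  have h := AEMeasurable.map_map_of_aemeasurable
    (g := fun z : J → E => (fun t : J => m t) + z) (by fun_prop) hJ.aemeasurable
  rw [Function.comp_def] at h
  change IsGaussian (P.map fun ω => (fun t : J => m t) + J.restrict fun t => X t ω)
  rw [← h]
  infer_instance

/-- The time change turning a Brownian motion into the bridge. -/
noncomputable def bridgeClock (lam T t : ℝ) : ℝ :=
  Real.sinh (lam * t) / (lam * Real.sinh (lam * T) * Real.sinh (lam * (T - t)))

lemma sinh_mul_nonneg {lam t : ℝ} (hlam : 0 < lam) (ht : 0 ≤ t) : 0 ≤ Real.sinh (lam * t) :=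
  Real.sinh_nonneg_iff.mpr (mul_nonneg hlam.le ht)

lemma bridgeClock_nonneg {lam T t : ℝ} (hlam : 0 < lam) (hT : 0 < T) (h0 : 0 ≤ t) (h1 : t ≤ T) :
    0 ≤ bridgeClock lam T t := by
  have h2 := sinh_mul_pos hlam hT
  have h3 := sinh_mul_nonneg hlam h0
  have h4 := sinh_mul_nonneg hlam (sub_nonneg.mpr h1)
  unfold bridgeClock; positivity

/-- The clock increases on [0, T), so the minimum is attained at the earlier time and one factor
sinh(λ(T-s)) cancels. -/
lemma sinh_mul_sinh_mul_min_bridgeClock {lam T s t : ℝ} (hlam : 0 < lam) (hT : 0 < T)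
    (hs0 : 0 ≤ s) (hs1 : s ≤ T) (ht0 : 0 ≤ t) (ht1 : t ≤ T) :
    Real.sinh (lam * (T - s)) * Real.sinh (lam * (T - t)) *
      min (bridgeClock lam T s) (bridgeClock lam T t) = bridgeCov lam T s t := by
  wlog hst : s ≤ t generalizing s t
  · rw [bridgeCov_comm, ← this ht0 ht1 hs0 hs1 (le_of_not_ge hst), min_comm]
    ring
  have h2 := sinh_mul_pos hlam hT
  rw [bridgeCov_of_le hst]
  -- At t = T the clock divides by zero; its value is irrelevant, since the factor sinh(λ(T-t))
  -- vanishes.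
  rcases ht1.eq_or_lt with rfl | htT
  · simp
  have h3 := sinh_mul_pos hlam (sub_pos.mpr htT)
  have h4 := sinh_mul_pos hlam (sub_pos.mpr (hst.trans_lt htT))
  have h5 := sinh_interp lam 0 s t T
  have h6 := mul_nonneg (sinh_mul_nonneg hlam (sub_nonneg.mpr hst)) h2.le
  simp only [sub_zero] at h5
  rw [min_eq_left]
  · unfold bridgeClock
    field_simp
  · unfold bridgeClock
    rw [div_le_div_iff₀ (by positivity) (by positivity)]
    have h7 : 0 < lam * Real.sinh (lam * T) := by positivity
    nlinarith

lemma exists_isAssociatedBernsteinProcess {N : ℕ} {lam T : ℝ} (hlam : 0 < lam) (hT : 0 < T)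
    (a : EuclideanSpace ℝ (Fin N)) :
    ∃ (Ω : Type) (_ : MeasurableSpace Ω) (P : Measure Ω)
        (Z : Set.Icc (0 : ℝ) T → Ω → EuclideanSpace ℝ (Fin N)),
      IsProbabilityMeasure P ∧ P.IsComplete ∧
      IsAssociatedBernsteinProcess (mehlerKernel lam) hT.le
        (diracDatum lam T a 0) (diracDatum lam T a a) Z P := by
  obtain ⟨Ω, mΩ, P, W, hP, hc, hWm, hWg, hW0, hWc⟩ :=
    exists_isonormal (Lp (EuclideanSpace ℝ (Fin N)) 2 (volume : Measure ℝ))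
  -- Applied to indicators of [0, τ] times basis vectors, the isonormal process is an N-dimensional
  -- Brownian motion at time τ, here the clock value.
  let e : Set.Icc (0 : ℝ) T → Fin N → Lp (EuclideanSpace ℝ (Fin N)) 2 (volume : Measure ℝ) :=
    fun t i => indicatorConstLp 2 (measurableSet_Icc (a := (0 : ℝ)) (b := bridgeClock lam T t))
      measure_Icc_lt_top.ne (EuclideanSpace.single i (1 : ℝ))
  have he : ∀ s t i j, inner ℝ (e s i) (e t j) =
      min (bridgeClock lam T s) (bridgeClock lam T t) * (if i = j then 1 else 0) := by
    intro s t i j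
    have hs := bridgeClock_nonneg hlam hT s.2.1 s.2.2
    have ht := bridgeClock_nonneg hlam hT t.2.1 t.2.2
    rw [L2.inner_indicatorConstLp_indicatorConstLp measurableSet_Icc measurableSet_Icc
      measure_Icc_lt_top.ne measure_Icc_lt_top.ne, Set.Icc_inter_Icc, sup_idem,
      Real.volume_real_Icc_of_le (le_min hs ht), sub_zero, smul_eq_mul]
    congr 1
    simp [EuclideanSpace.inner_single_left]
  let X : Set.Icc (0 : ℝ) T → Ω → EuclideanSpace ℝ (Fin N) := fun t ω =>
    WithLp.toLp 2 fun i => Real.sinh (lam * (T - t)) * W (e t i) ω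
  have hXm : ∀ t, Measurable (X t) := fun t => by
    refine (WithLp.measurable_toLp 2 (Fin N → ℝ)).comp (measurable_pi_lambda _ fun i => ?_)
    exact (hWm _).const_mul _
  have hXg : IsGaussianProcess X P := by
    classical
    refine hWg.of_isGaussianProcess fun t => ⟨Finset.univ.image (e t),
      (PiLp.continuousLinearEquiv 2 ℝ (fun _ : Fin N => ℝ)).symm.toContinuousLinearMap ∘L
        ContinuousLinearMap.pi fun i => Real.sinh (lam * (T - t)) •
          ContinuousLinearMap.proj ⟨e t i, by simp⟩, fun ω => ?_⟩
    ext i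
    simp [X]
  have hX0 : ∀ t, ∫ ω, X t ω ∂P = 0 := fun t => by
    refine ext_inner_left ℝ fun x => ?_
    rw [← integral_inner (hXg.hasGaussianLaw_eval t).integrable, inner_zero_right]
    have : ∀ ω, inner ℝ x (X t ω) = ∑ i, (Real.sinh (lam * (T - t)) * x i) * W (e t i) ω := by
      intro ω
      rw [PiLp.inner_apply]
      refine Finset.sum_congr rfl fun i _ => ?_
      simp [X]
      ring
    simp_rw [this]
    rw [integral_finsetSum _ fun i _ => (hWg.hasGaussianLaw_eval (e t i)).integrable.const_mul _]
    simp [integral_const_mul, hW0]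
  have hXc : ∀ s t x y, cov[fun ω => inner ℝ x (X s ω), fun ω => inner ℝ y (X t ω); P] =
      bridgeCov lam T s t * inner ℝ x y := by
    intro s t x y
    have : ∀ t x, (fun ω => inner ℝ x (X t ω)) =
        fun ω => ∑ i, (Real.sinh (lam * (T - t)) * x i) * W (e t i) ω := by
      intro t x
      ext ω
      rw [PiLp.inner_apply]
      refine Finset.sum_congr rfl fun i _ => ?_
      simp [X]
      ring
    have h2 : ∀ h, MemLp (W h) 2 P := fun h => (hWg.hasGaussianLaw_eval h).memLp_two
    rw [this, this, covariance_fun_sum_fun_sum (fun i => (h2 _).const_mul _)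
      fun i => (h2 _).const_mul _]
    simp_rw [covariance_const_mul_left, covariance_const_mul_right]
    have hc : ∀ i j, cov[fun ω => W (e s i) ω, fun ω => W (e t j) ω; P] =
      min (bridgeClock lam T s) (bridgeClock lam T t) * (if i = j then 1 else 0) :=
      fun i j => (hWc _ _).trans (he _ _ _ _)
    simp_rw [hc]
    rw [← sinh_mul_sinh_mul_min_bridgeClock hlam hT s.2.1 s.2.2 t.2.1 t.2.2, PiLp.inner_apply,
      Finset.mul_sum]
    refine Finset.sum_congr rfl fun i _ => ?_
    rw [Finset.sum_eq_single i]
    · simp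
      ring
    · intro j _ hj
      simp [hj.symm]
    · simp
  refine ⟨Ω, mΩ, P, fun t ω => bridgeMean lam T a t + X t ω, hP, hc,
    isAssociatedBernsteinProcess_of_isGaussianProcess hlam hT (fun t => (hXm t).const_add _)
      (isGaussianProcess_const_add hXg _) (fun t => ?_) (fun s t x y => ?_)⟩
  · rw [integral_add (integrable_const _) (hXg.hasGaussianLaw_eval t).integrable, hX0]
    simp
  · simp_rw [inner_add_right]
    have hi : ∀ t x, Integrable (fun ω => inner ℝ x (X t ω)) P := fun t x =>
      (hXg.hasGaussianLaw_eval t).integrable.const_inner x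
    rw [covariance_const_add_left (hi s x), covariance_const_add_right (hi t y), hXc]

/-! ### Properties of every associated process. -/

/-- Random variables that are adapted to a filtration with a shift, each independent of the
preceding σ-algebra, are mutually independent. -/
lemma iIndepFun_of_indep_of_monotone {Ω E : Type*} {mΩ : MeasurableSpace Ω} [MeasurableSpace E]
    {P : Measure Ω} [IsProbabilityMeasure P] {f : ℕ → Ω → E} {F : ℕ → MeasurableSpace Ω}
    (hF : Monotone F) (hf : ∀ n, Measurable[F (n + 1)] (f n))
    (hindep : ∀ n, Indep (F n) (MeasurableSpace.comap (f n) inferInstance) P) :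
    iIndepFun f P := by
  rw [iIndepFun_iff_measure_inter_preimage_eq_mul]
  intro S
  induction S using Finset.induction_on_max with
  | empty => intro sets _; simp
  | insert m S hm ih =>
    intro sets hsets
    have hmS : m ∉ S := fun h => lt_irrefl _ (hm m h)
    rw [Finset.set_biInter_insert, Finset.prod_insert hmS, Set.inter_comm,
      ← ih fun i hi => hsets i (Finset.mem_insert_of_mem hi), mul_comm]
    -- Every index in `S` lies below `m`, so the intersection over `S` is an event of `F m`.
    refine (Indep_iff _ _ _).mp (hindep m) _ _ ?_ ?_
    · exact Finset.measurableSet_biInter S fun i hi =>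
        hF (hm i hi) _ (hf i (hsets i (Finset.mem_insert_of_mem hi)))
    · exact ⟨sets m, hsets m (Finset.mem_insert_self _ _), rfl⟩

section Properties

variable {N : ℕ} {lam T : ℝ} {Ω : Type*} {mΩ : MeasurableSpace Ω} {P : Measure Ω}
  {Z : Set.Icc (0 : ℝ) T → Ω → EuclideanSpace ℝ (Fin N)} {a : EuclideanSpace ℝ (Fin N)}

lemma bridgeMean_zero (lam T : ℝ) (a : EuclideanSpace ℝ (Fin N)) : bridgeMean lam T a 0 = 0 := by
  simp [bridgeMean]

lemma bridgeMean_right (hlam : 0 < lam) (hT : 0 < T) (a : EuclideanSpace ℝ (Fin N)) :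
    bridgeMean lam T a T = a := by
  simp [bridgeMean, (sinh_mul_pos hlam hT).ne']

lemma ae_endpoints_of_isAssociated (hlam : 0 < lam) (hT : 0 < T)
    (h : IsAssociatedBernsteinProcess (mehlerKernel lam) hT.le (diracDatum lam T a 0)
      (diracDatum lam T a a) Z P) :
    ∀ᵐ ω ∂P, Z ⟨0, Set.left_mem_Icc.mpr hT.le⟩ ω = 0 ∧
      Z ⟨T, Set.right_mem_Icc.mpr hT.le⟩ ω = a := by
  have hl : HasLaw (fun ω => (Z ⟨0, Set.left_mem_Icc.mpr hT.le⟩ ω,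
      Z ⟨T, Set.right_mem_Icc.mpr hT.le⟩ ω)) (Measure.dirac ((0 : EuclideanSpace ℝ (Fin N)), a)) P :=
    ⟨((h.measurable _).prodMk (h.measurable _)).aemeasurable, by
      rw [h.endpoints, markovianMeasure_diracDatum hlam hT]⟩
  filter_upwards [hl.ae_eq_of_dirac] with ω hω
  exact Prod.mk.injEq _ _ _ _ ▸ hω

lemma memLp_apply_of_hasLaw {X : Ω → EuclideanSpace ℝ (Fin N)} {v : ℝ}
    (hX : HasLaw X (heatMeasure N v) P) (i : Fin N) : MemLp (fun ω => X ω i) 2 P :=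
  (hX.hasGaussianLaw.map_fun (EuclideanSpace.proj i)).memLp_two

lemma integral_eq_zero_of_hasLaw {X : Ω → EuclideanSpace ℝ (Fin N)} {v : ℝ}
    (hX : HasLaw X (heatMeasure N v) P) : ∫ ω, X ω ∂P = 0 := by
  rw [hX.integral_eq, integral_id_heatMeasure]

lemma integral_apply_eq_zero_of_hasLaw {X : Ω → EuclideanSpace ℝ (Fin N)} {v : ℝ}
    (hX : HasLaw X (heatMeasure N v) P) (i : Fin N) : ∫ ω, X ω i ∂P = 0 := by
  have h := (EuclideanSpace.proj (𝕜 := ℝ) i).integral_comp_comm hX.hasGaussianLaw.integrable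
  rw [integral_eq_zero_of_hasLaw hX, map_zero] at h
  exact h

variable [IsProbabilityMeasure P]

/-- The residual of the process at time `r` with respect to its state at an earlier time `s`. -/
lemma forward_residual (hlam : 0 < lam) (hT : 0 < T)
    (h : IsAssociatedBernsteinProcess (mehlerKernel lam) hT.le (diracDatum lam T a 0)
      (diracDatum lam T a a) Z P) {s r : Set.Icc (0 : ℝ) T} (hsr : s < r) (hrT : (r : ℝ) < T) :
    P.map (fun ω => Z r ω - (rightWeight lam s r T • a + leftWeight lam s r T • Z s ω)) =
      heatMeasure N (gapVar lam (T - r) (r - s)) ∧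
    Indep (past Z s) (MeasurableSpace.comap (fun ω => Z r ω -
      (rightWeight lam s r T • a + leftWeight lam s r T • Z s ω)) inferInstance) P := by
  -- With the right time equal to T, where the state is almost surely `a`, the interpolated mean
  -- depends on Z_s alone and is measurable for the past.
  set tT : Set.Icc (0 : ℝ) T := ⟨T, Set.right_mem_Icc.mpr hT.le⟩ with htT
  have hrT' : r < tT := hrT
  have hle : past Z s ⊔ future Z tT ≤ mΩ :=
    sup_le (past_le h.measurable s) (future_le h.measurable tT)
  have hM : Measurable[past Z s] fun ω => rightWeight lam s r T • a +
      leftWeight lam s r T • Z s ω :=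
    (show Measurable fun z => rightWeight lam s r T • a + leftWeight lam s r T • z by
      fun_prop).comp (measurable_past Z le_rfl)
  have hcond : ∀ A : Set (EuclideanSpace ℝ (Fin N)), MeasurableSet A →
      P⟦Z r ⁻¹' A | past Z s ⊔ future Z tT⟧ =ᵐ[P] fun ω =>
        (heatMeasure N (gapVar lam (T - r) (r - s))).real
          {w | w + (rightWeight lam s r T • a + leftWeight lam s r T • Z s ω) ∈ A} := by
    intro A hA
    have h1 := h.reciprocal (A.indicator fun _ => 1) (measurable_const.indicator hA)
      ⟨1, fun x => by by_cases h : x ∈ A <;> simp [h]⟩ s r tT hsr hrT'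
    have h2 := h.transition A hA s r tT hsr hrT'
    refine (h1.trans h2).trans ?_
    filter_upwards [ae_endpoints_of_isAssociated hlam hT h] with ω hω
    rw [bernsteinTransition_mehlerKernel hlam hsr hrT' _ _ hA, hω.2]
    rfl
  obtain ⟨h1, h2⟩ := indep_sub_of_condExp_indicator hle (hM.mono le_sup_left le_rfl)
    (h.measurable r) hcond
  exact ⟨h1, indep_of_indep_of_le_left h2 le_sup_left⟩

/-- The mean curve is itself interpolated and ends at a, so the centred process satisfies a linear
recursion without drift. -/
lemma residual_eq (hlam : 0 < lam) (hT : 0 < T) (a : EuclideanSpace ℝ (Fin N)) {s r : ℝ}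
    (hsT : s < T) (x y : EuclideanSpace ℝ (Fin N)) :
    y - (rightWeight lam s r T • a + leftWeight lam s r T • x) =
      (y - bridgeMean lam T a r) - leftWeight lam s r T • (x - bridgeMean lam T a s) := by
  rw [bridgeMean_eq_weights hlam hsT a r, bridgeMean_right hlam hT]
  module

lemma hasLaw_sub_bridgeMean_of_isAssociated (hlam : 0 < lam) (hT : 0 < T)
    (h : IsAssociatedBernsteinProcess (mehlerKernel lam) hT.le (diracDatum lam T a 0)
      (diracDatum lam T a a) Z P) (t : Set.Icc (0 : ℝ) T) :
    HasLaw (fun ω => Z t ω - bridgeMean lam T a t) (heatMeasure N (bridgeVar lam T t)) P := by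
  have hends := ae_endpoints_of_isAssociated hlam hT h
  rcases t.2.1.eq_or_lt with h0 | h0
  · obtain rfl : t = ⟨0, Set.left_mem_Icc.mpr hT.le⟩ := Subtype.ext h0.symm
    have e : bridgeVar lam T 0 = 0 := by simp [bridgeVar]
    dsimp only
    rw [e, heatMeasure_zero, bridgeMean_zero]
    exact hasLaw_dirac_of_ae_eq (hends.mono fun ω hω => by simp [hω.1])
  rcases t.2.2.eq_or_lt with h1 | h1
  · obtain rfl : t = ⟨T, Set.right_mem_Icc.mpr hT.le⟩ := Subtype.ext h1
    have e : bridgeVar lam T T = 0 := by simp [bridgeVar]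
    dsimp only
    rw [e, heatMeasure_zero, bridgeMean_right hlam hT]
    exact hasLaw_dirac_of_ae_eq (hends.mono fun ω hω => by simp [hω.2])
  -- Starting from time 0, where the centred state vanishes almost surely, the residual is the
  -- centred state at `t`.
  · obtain ⟨hlaw, -⟩ := forward_residual hlam hT h
      (s := ⟨0, Set.left_mem_Icc.mpr hT.le⟩) (r := t) h0 h1
    refine ⟨((h.measurable t).sub_const _).aemeasurable, ?_⟩
    rw [bridgeVar_eq_gapVar]
    dsimp only at hlaw
    rw [sub_zero] at hlaw
    rw [← hlaw]
    refine Measure.map_congr (hends.mono fun ω hω => ?_)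
    dsimp only
    rw [residual_eq hlam hT a hT, hω.1, bridgeMean_zero]
    simp

/-- The bridge, rescaled to a process with independent increments. -/
noncomputable def rescaledBridge (lam : ℝ) {T : ℝ} (a : EuclideanSpace ℝ (Fin N))
    (Z : Set.Icc (0 : ℝ) T → Ω → EuclideanSpace ℝ (Fin N)) (t : Set.Ico (0 : ℝ) T) (ω : Ω) :
    EuclideanSpace ℝ (Fin N) :=
  (Real.sinh (lam * (T - t)))⁻¹ • (Z ⟨t, t.2.1, t.2.2.le⟩ ω - bridgeMean lam T a t)

lemma measurable_rescaledBridge {s : Set.Icc (0 : ℝ) T} {t : Set.Ico (0 : ℝ) T}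
    (hts : (t : ℝ) ≤ s) : Measurable[past Z s] (rescaledBridge lam a Z t) :=
  (show Measurable fun z => (Real.sinh (lam * (T - t)))⁻¹ • (z - bridgeMean lam T a t) by
    fun_prop).comp (measurable_past Z (τ := ⟨t, t.2.1, t.2.2.le⟩) hts)

lemma indep_rescaledBridge_sub (hlam : 0 < lam) (hT : 0 < T)
    (h : IsAssociatedBernsteinProcess (mehlerKernel lam) hT.le (diracDatum lam T a 0)
      (diracDatum lam T a a) Z P) {s r : Set.Ico (0 : ℝ) T} (hsr : s ≤ r) :
    Indep (past Z ⟨s, s.2.1, s.2.2.le⟩) (MeasurableSpace.comap (fun ω =>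
      rescaledBridge lam a Z r ω - rescaledBridge lam a Z s ω) inferInstance) P := by
  rcases hsr.eq_or_lt with rfl | hsr
  · simp only [sub_self, MeasurableSpace.comap_const]
    exact indep_bot_right _
  · obtain ⟨-, hi⟩ := forward_residual hlam hT h (s := ⟨s, s.2.1, s.2.2.le⟩)
      (r := ⟨r, r.2.1, r.2.2.le⟩) hsr r.2.2
    refine indep_of_indep_of_le_right hi ?_
    -- `leftWeight lam s r T` is sinh(λ(T-r)) / sinh(λ(T-s)), so after rescaling the recursion has
    -- coefficient 1 and the increment is a multiple of the residual.
    have e : (fun ω => rescaledBridge lam a Z r ω - rescaledBridge lam a Z s ω) =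
        (fun z => (Real.sinh (lam * (T - r)))⁻¹ • z) ∘ fun ω => Z ⟨r, r.2.1, r.2.2.le⟩ ω -
          (rightWeight lam s r T • a + leftWeight lam s r T • Z ⟨s, s.2.1, s.2.2.le⟩ ω) := by
      ext1 ω
      have h1 := (sinh_mul_pos hlam (sub_pos.mpr r.2.2)).ne'
      have h2 := (sinh_mul_pos hlam (sub_pos.mpr s.2.2)).ne'
      rw [Function.comp_apply, residual_eq hlam hT a s.2.2, smul_sub, smul_smul]
      unfold rescaledBridge leftWeight
      congr 2
      field_simp
    rw [e]
    exact ((measurable_const_smul _).comp (comap_measurable _)).comap_le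

lemma hasIndepIncrements_rescaledBridge (hlam : 0 < lam) (hT : 0 < T)
    (h : IsAssociatedBernsteinProcess (mehlerKernel lam) hT.le (diracDatum lam T a 0)
      (diracDatum lam T a a) Z P) : HasIndepIncrements (rescaledBridge lam a Z) P := by
  refine HasIndepIncrements.of_nat fun t ht _ => ?_
  refine iIndepFun_of_indep_of_monotone
    (F := fun n => past Z ⟨t n, (t n).2.1, (t n).2.2.le⟩)
    (fun m n hmn => past_mono Z (ht hmn)) (fun n => ?_)
    (fun n => indep_rescaledBridge_sub hlam hT h (ht n.le_succ))
  exact (measurable_rescaledBridge le_rfl).sub (measurable_rescaledBridge (ht n.le_succ))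

lemma isGaussianProcess_of_isAssociated (hlam : 0 < lam) (hT : 0 < T)
    (h : IsAssociatedBernsteinProcess (mehlerKernel lam) hT.le (diracDatum lam T a 0)
      (diracDatum lam T a a) Z P) : IsGaussianProcess Z P := by
  have : Fact ((0 : ℝ) < T) := ⟨hT⟩
  have hends := ae_endpoints_of_isAssociated hlam hT h
  have hX : IsGaussianProcess (rescaledBridge lam a Z) P := by
    refine HasIndepIncrements.isGaussianProcess (fun t => ?_) ?_
      (hasIndepIncrements_rescaledBridge hlam hT h)
    · exact HasGaussianLaw.fun_smul _
        (hasLaw_sub_bridgeMean_of_isAssociated hlam hT h ⟨t, t.2.1, t.2.2.le⟩).hasGaussianLaw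
    · refine hends.mono fun ω hω => ?_
      change (Real.sinh (lam * (T - 0)))⁻¹ • (Z ⟨0, _⟩ ω - bridgeMean lam T a 0) = 0
      rw [hω.1, bridgeMean_zero, sub_self, smul_zero]
  -- Undoing the rescaling recovers the centred process before T. At T it is almost surely zero,
  -- whence the value in the `else` branch.
  have hY : IsGaussianProcess (fun (t : Set.Icc (0 : ℝ) T) ω => if ht : (t : ℝ) < T then
      Real.sinh (lam * (T - t)) • rescaledBridge lam a Z ⟨t, t.2.1, ht⟩ ω else 0) P := by
    refine hX.of_isGaussianProcess fun t => ?_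
    by_cases ht : (t : ℝ) < T
    · exact ⟨{⟨t, t.2.1, ht⟩}, Real.sinh (lam * (T - t)) • .proj ⟨⟨t, t.2.1, ht⟩, by simp⟩,
        fun ω => by simp [ht]⟩
    · exact ⟨∅, 0, fun ω => by simp [ht]⟩
  refine (isGaussianProcess_const_add hY fun t => bridgeMean lam T a t).congr fun t => ?_
  rcases t.2.2.lt_or_eq with ht | ht
  · refine ae_of_all _ fun ω => ?_
    dsimp only
    rw [dif_pos ht, rescaledBridge, smul_smul,
      mul_inv_cancel₀ (sinh_mul_pos hlam (sub_pos.mpr ht)).ne', one_smul, add_sub_cancel]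
  · obtain rfl : t = ⟨T, Set.right_mem_Icc.mpr hT.le⟩ := Subtype.ext ht
    refine hends.mono fun ω hω => ?_
    simp [hω.2, bridgeMean_right hlam hT]

/-- Taking G to be the whole past of s, then σ(Z_s), gives the same answer, which is the Markov
property for t < T. -/
lemma condExp_eq_of_isAssociated {Ω : Type*} {G mΩ : MeasurableSpace Ω} {P : Measure Ω}
    [IsProbabilityMeasure P] {Z : Set.Icc (0 : ℝ) T → Ω → EuclideanSpace ℝ (Fin N)}
    (hlam : 0 < lam) (hT : 0 < T)
    (h : IsAssociatedBernsteinProcess (mehlerKernel lam) hT.le (diracDatum lam T a 0)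
      (diracDatum lam T a a) Z P) {s r : Set.Icc (0 : ℝ) T} (hsr : s < r) (hrT : (r : ℝ) < T)
    (hsG : Measurable[G] (Z s)) (hG : G ≤ past Z s)
    {f : EuclideanSpace ℝ (Fin N) → ℝ} (hf : Measurable f) (hb : ∃ C : ℝ, ∀ x, |f x| ≤ C) :
    P[fun ω => f (Z r ω) | G] =ᵐ[P] fun ω =>
      ∫ w, f (w + (rightWeight lam s r T • a + leftWeight lam s r T • Z s ω))
        ∂heatMeasure N (gapVar lam (T - r) (r - s)) := by
  obtain ⟨hlaw, hind⟩ := forward_residual hlam hT h hsr hrT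
  have hg : Measurable fun z => rightWeight lam s r T • a + leftWeight lam s r T • z := by
    fun_prop
  have hξ : Measurable fun ω => Z r ω - (rightWeight lam s r T • a +
      leftWeight lam s r T • Z s ω) := (h.measurable r).sub (hg.comp (h.measurable s))
  have h := condExp_comp_add_of_indep (hG.trans (past_le h.measurable s)) (hg.comp hsG) hξ hlaw
    (indep_of_indep_of_le_left hind hG) hf hb
  simp only [Function.comp_apply, sub_add_cancel] at h
  exact h

lemma isMarkovProcess_of_isAssociated (hlam : 0 < lam) (hT : 0 < T)
    (h : IsAssociatedBernsteinProcess (mehlerKernel lam) hT.le (diracDatum lam T a 0)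
      (diracDatum lam T a a) Z P) : IsMarkovProcess Z P := by
  refine ⟨h.measurable, fun f hf hb s t hst => ?_⟩
  have hle : MeasurableSpace.comap (Z s) inferInstance ≤ past Z s :=
    (measurable_past Z le_rfl).comap_le
  have hint : Integrable (fun ω => f (Z t ω)) P := by
    obtain ⟨C, hC⟩ := hb
    exact .of_bound (hf.comp (h.measurable t)).aestronglyMeasurable C (ae_of_all _ fun ω => hC _)
  rcases hst.eq_or_lt with rfl | hst
  · have h1 : StronglyMeasurable[past Z s] fun ω => f (Z s ω) :=
      (hf.comp (measurable_past Z le_rfl)).stronglyMeasurable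
    have h2 : StronglyMeasurable[MeasurableSpace.comap (Z s) inferInstance] fun ω => f (Z s ω) :=
      (hf.comp (comap_measurable (Z s))).stronglyMeasurable
    rw [condExp_of_stronglyMeasurable (past_le h.measurable s) h1 hint,
      condExp_of_stronglyMeasurable (h.measurable s).comap_le h2 hint]
  rcases t.2.2.lt_or_eq with ht | ht
  · exact (condExp_eq_of_isAssociated hlam hT h hst ht (measurable_past Z le_rfl) le_rfl hf
      hb).trans (condExp_eq_of_isAssociated hlam hT h hst ht (comap_measurable _) hle hf hb).symm
  · obtain rfl : t = ⟨T, Set.right_mem_Icc.mpr hT.le⟩ := Subtype.ext ht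
    have e : (fun ω => f (Z ⟨T, Set.right_mem_Icc.mpr hT.le⟩ ω)) =ᵐ[P] fun _ => f a :=
      (ae_endpoints_of_isAssociated hlam hT h).mono fun ω hω => by
        dsimp only
        rw [hω.2]
    refine (condExp_congr_ae e).trans (Filter.EventuallyEq.trans ?_ (condExp_congr_ae e).symm)
    rw [condExp_const (past_le h.measurable s), condExp_const (h.measurable s).comap_le]

lemma integral_apply_mul_apply_of_hasLaw {X : Ω → EuclideanSpace ℝ (Fin N)} {v : ℝ} (hv : 0 ≤ v)
    (hX : HasLaw X (heatMeasure N v) P) (i j : Fin N) :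
    ∫ ω, X ω i * X ω j ∂P = v * (if i = j then 1 else 0) := by
  have h := covariance_eq_sub (memLp_apply_of_hasLaw hX i) (memLp_apply_of_hasLaw hX j)
  rw [integral_apply_eq_zero_of_hasLaw hX i, zero_mul, sub_zero] at h
  have h2 := hX.covariance_fun_comp (f := fun w => w i) (g := fun w => w j) (by fun_prop)
    (by fun_prop)
  rw [← covariance_apply_heatMeasure hv, ← h2, h]
  rfl

lemma integral_mul_of_isAssociated_of_le (hlam : 0 < lam) (hT : 0 < T)
    (h : IsAssociatedBernsteinProcess (mehlerKernel lam) hT.le (diracDatum lam T a 0)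
      (diracDatum lam T a a) Z P) {s t : Set.Icc (0 : ℝ) T} (hst : s ≤ t) (i j : Fin N) :
    ∫ ω, (Z s ω i - bridgeMean lam T a s i) * (Z t ω j - bridgeMean lam T a t j) ∂P =
      bridgeCov lam T s t * (if i = j then 1 else 0) := by
  have hs := hasLaw_sub_bridgeMean_of_isAssociated hlam hT h s
  have hvar := integral_apply_mul_apply_of_hasLaw (bridgeVar_nonneg hlam hT s.2.1 s.2.2) hs
  rcases hst.eq_or_lt with rfl | hst'
  · rw [bridgeCov_self, ← hvar i j]
    rfl
  rcases t.2.2.lt_or_eq with ht | ht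
  · obtain ⟨hlaw, hind⟩ := forward_residual hlam hT h hst' ht
    have hsT : (s : ℝ) < T := lt_trans hst' ht
    set ξ : Ω → EuclideanSpace ℝ (Fin N) := fun ω => Z t ω - (rightWeight lam s t T • a +
      leftWeight lam s t T • Z s ω) with hξ
    have hξm : Measurable ξ := by
      have := h.measurable s; have := h.measurable t
      fun_prop
    have hξl : HasLaw ξ (heatMeasure N (gapVar lam (T - t) (t - s))) P := ⟨hξm.aemeasurable, hlaw⟩
    have hξi : IndepFun (fun ω => Z s ω i - bridgeMean lam T a s i) (fun ω => ξ ω j) P := by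
      have h1 : IndepFun (Z s) ξ P :=
        indep_of_indep_of_le_left hind (measurable_past Z le_rfl).comap_le
      exact h1.comp (φ := fun z => z i - bridgeMean lam T a s i) (ψ := fun z => z j)
        (by fun_prop) (by fun_prop)
    -- The first term integrates to zero, as the residual is centred and independent of Z_s; the
    -- second gives `leftWeight` times the variance at `s`.
    have e : ∀ ω, (Z s ω i - bridgeMean lam T a s i) * (Z t ω j - bridgeMean lam T a t j) =
        (Z s ω i - bridgeMean lam T a s i) * ξ ω j + leftWeight lam s t T *
          ((Z s ω i - bridgeMean lam T a s i) * (Z s ω j - bridgeMean lam T a s j)) := by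
      intro ω
      have h1 := congrArg (fun z : EuclideanSpace ℝ (Fin N) => z j)
        (residual_eq hlam hT a (r := t) hsT (Z s ω) (Z t ω))
      simp only [hξ]
      rw [show (Z t ω - (rightWeight lam s t T • a + leftWeight lam s t T • Z s ω)) j = _ from h1]
      simp only [PiLp.sub_apply, PiLp.smul_apply, smul_eq_mul]
      ring
    have i1 : MemLp (fun ω => Z s ω i - bridgeMean lam T a s i) 2 P := memLp_apply_of_hasLaw hs i
    have i2 : MemLp (fun ω => Z s ω j - bridgeMean lam T a s j) 2 P := memLp_apply_of_hasLaw hs j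
    have i3 := memLp_apply_of_hasLaw hξl j
    simp_rw [e]
    have j1 : Integrable (fun ω => (Z s ω i - bridgeMean lam T a s i) * ξ ω j) P :=
      i1.integrable_mul i3
    have j2 : Integrable (fun ω => (Z s ω i - bridgeMean lam T a s i) *
      (Z s ω j - bridgeMean lam T a s j)) P := i1.integrable_mul i2
    rw [integral_add j1 (j2.const_mul _), integral_const_mul]
    have h1 : ∫ ω, (Z s ω i - bridgeMean lam T a s i) * ξ ω j ∂P = 0 := by
      have := hξi.integral_mul_eq_mul_integral i1.1 i3.1
      rw [integral_apply_eq_zero_of_hasLaw hξl j, mul_zero] at this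
      exact this
    have h2 : ∫ ω, (Z s ω i - bridgeMean lam T a s i) * (Z s ω j - bridgeMean lam T a s j) ∂P =
      bridgeVar lam T s * (if i = j then 1 else 0) := hvar i j
    rw [h1, h2, zero_add, ← mul_assoc, bridgeCov_of_le hst]
    congr 1
    have h3 := (sinh_mul_pos hlam (sub_pos.mpr hsT)).ne'
    unfold leftWeight bridgeVar
    field_simp
  · obtain rfl : t = ⟨T, Set.right_mem_Icc.mpr hT.le⟩ := Subtype.ext ht
    rw [bridgeCov_of_le hst]
    dsimp only
    rw [sub_self, mul_zero, Real.sinh_zero, zero_mul, zero_div, zero_mul]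
    refine integral_eq_zero_of_ae ((ae_endpoints_of_isAssociated hlam hT h).mono fun ω hω => ?_)
    simp [hω.2, bridgeMean_right hlam hT]

lemma integral_mul_of_isAssociated (hlam : 0 < lam) (hT : 0 < T)
    (h : IsAssociatedBernsteinProcess (mehlerKernel lam) hT.le (diracDatum lam T a 0)
      (diracDatum lam T a a) Z P) (s t : Set.Icc (0 : ℝ) T) (i j : Fin N) :
    ∫ ω, (Z s ω i - bridgeMean lam T a s i) * (Z t ω j - bridgeMean lam T a t j) ∂P =
      bridgeCov lam T s t * (if i = j then 1 else 0) := by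
  rcases le_total s t with hst | hst
  · exact integral_mul_of_isAssociated_of_le hlam hT h hst i j
  · rw [bridgeCov_comm]
    simp_rw [mul_comm (Z s _ i - _), eq_comm (a := i)]
    exact integral_mul_of_isAssociated_of_le hlam hT h hst j i

lemma bridgeVar_half (lam T : ℝ) :
    bridgeVar lam T (T / 2) = Real.sinh (lam * T / 2) ^ 2 / (lam * Real.sinh (lam * T)) := by
  unfold bridgeVar
  rw [show lam * (T - T / 2) = lam * T / 2 by ring, show lam * (T / 2) = lam * T / 2 by ring, sq]

lemma bridgeVar_lt_bridgeVar_half (hlam : 0 < lam) (hT : 0 < T) {t : ℝ} (ht : t ≠ T / 2) :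
    bridgeVar lam T t < bridgeVar lam T (T / 2) := by
  have hTp := sinh_mul_pos hlam hT
  have hne : lam * (t - T / 2) ≠ 0 := mul_ne_zero hlam.ne' (sub_ne_zero.mpr ht)
  have h1 := sq_pos_of_ne_zero (mt Real.sinh_eq_zero.mp hne)
  -- Centring time at T/2 makes the deficit from the maximum an explicit square.
  have e : Real.sinh (lam * (T - t)) * Real.sinh (lam * t) =
      Real.sinh (lam * (T / 2)) ^ 2 - Real.sinh (lam * (t - T / 2)) ^ 2 := by
    rw [show lam * (T - t) = lam * (T / 2) - lam * (t - T / 2) by ring,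
      show lam * t = lam * (T / 2) + lam * (t - T / 2) by ring, Real.sinh_sub, Real.sinh_add]
    have h2 := Real.cosh_sq (lam * (T / 2))
    have h3 := Real.cosh_sq (lam * (t - T / 2))
    linear_combination Real.sinh (lam * (T / 2)) ^ 2 * h3 -
      Real.sinh (lam * (t - T / 2)) ^ 2 * h2
  unfold bridgeVar
  rw [e, show lam * (T - T / 2) = lam * (T / 2) by ring, ← sq]
  gcongr
  linarith

lemma variance_apply_of_isAssociated (hlam : 0 < lam) (hT : 0 < T)
    (h : IsAssociatedBernsteinProcess (mehlerKernel lam) hT.le (diracDatum lam T a 0)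
      (diracDatum lam T a a) Z P) (t : Set.Icc (0 : ℝ) T) (i : Fin N) :
    Var[fun ω => Z t ω i; P] = bridgeVar lam T t := by
  have ht := hasLaw_sub_bridgeMean_of_isAssociated hlam hT h t
  have h1 := integral_apply_mul_apply_of_hasLaw (bridgeVar_nonneg hlam hT t.2.1 t.2.2) ht i i
  have h0 : ∫ ω, (Z t ω i - bridgeMean lam T a t i) ∂P = 0 :=
    integral_apply_eq_zero_of_hasLaw ht i
  have hm : AEMeasurable (fun ω => Z t ω i) P := by
    have := h.measurable t
    fun_prop
  rw [← variance_sub_const hm.aestronglyMeasurable (bridgeMean lam T a t i),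
    variance_of_integral_eq_zero (by fun_prop) h0]
  simpa [sq] using h1

lemma measureReal_mem_of_isAssociated (hlam : 0 < lam) (hT : 0 < T)
    (h : IsAssociatedBernsteinProcess (mehlerKernel lam) hT.le (diracDatum lam T a 0)
      (diracDatum lam T a a) Z P) (t : Set.Icc (0 : ℝ) T) (ht0 : 0 < (t : ℝ)) (htT : (t : ℝ) < T)
    {A : Set (EuclideanSpace ℝ (Fin N))} (hA : MeasurableSet A) :
    P.real {ω | Z t ω ∈ A} = (2 * Real.pi * bridgeVar lam T t) ^ (-(N : ℝ) / 2) *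
      ∫ x in A, Real.exp (-‖x - bridgeMean lam T a t‖ ^ 2 / (2 * bridgeVar lam T t)) := by
  have ht := hasLaw_sub_bridgeMean_of_isAssociated hlam hT h t
  have hA' : MeasurableSet {w | w + bridgeMean lam T a t ∈ A} := measurable_add_const _ hA
  have h1 := ht.measureReal_eq hA'
  have hv : 0 < bridgeVar lam T t := by
    rw [bridgeVar_eq_gapVar]; exact gapVar_pos hlam (sub_pos.mpr htT) ht0
  simp only [sub_add_cancel] at h1
  rw [h1, heatMeasure_real_add_preimage hv hA, ← integral_const_mul]
  rfl

lemma not_isStationary_of_isAssociated (hN : 0 < N) (hlam : 0 < lam) (hT : 0 < T)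
    (h : IsAssociatedBernsteinProcess (mehlerKernel lam) hT.le (diracDatum lam T a 0)
      (diracDatum lam T a a) Z P) : ¬ IsStationary Z P := by
  intro hstat
  have hmem : (0 : ℝ) + T / 2 ∈ Set.Icc (0 : ℝ) T := by constructor <;> linarith
  -- A one-point marginal suffices: the shift takes time 0, with variance zero, to T/2, with
  -- positive variance.
  have h1 := hstat 1 (fun _ => ⟨0, Set.left_mem_Icc.mpr hT.le⟩) (T / 2) (fun _ => hmem)
  have hm : ∀ t, Measurable fun ω (_ : Fin 1) => Z t ω := fun t =>
    measurable_pi_lambda _ fun _ => h.measurable t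
  have hc : Measurable fun z : Fin 1 → EuclideanSpace ℝ (Fin N) => z 0 ⟨0, hN⟩ :=
    (EuclideanSpace.proj (𝕜 := ℝ) (⟨0, hN⟩ : Fin N)).continuous.measurable.comp
      (measurable_pi_apply 0)
  have hvar : ∀ t, Var[fun z : Fin 1 → EuclideanSpace ℝ (Fin N) => z 0 ⟨0, hN⟩;
      P.map fun ω (_ : Fin 1) => Z t ω] = bridgeVar lam T t := fun t => by
    rw [variance_map hc.aemeasurable (hm t).aemeasurable, ← variance_apply_of_isAssociated hlam hT h
      t ⟨0, hN⟩]
    rfl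
  have h2 := hvar ⟨0, Set.left_mem_Icc.mpr hT.le⟩
  rw [h1, hvar] at h2
  dsimp only at h2
  have h3 := bridgeVar_lt_bridgeVar_half hlam hT (t := 0) (by linarith)
  rw [zero_add] at h2
  exact h3.ne' h2

end Properties

/-! ### The Mehler kernel as a Green function. -/

section Green

variable {N : ℕ} {lam : ℝ}

lemma hasFDerivAt_exp_quadratic (α β : ℝ) (w x : EuclideanSpace ℝ (Fin N)) :
    HasFDerivAt (fun z => Real.exp (α - β / 2 * ‖z‖ ^ 2 + inner ℝ w z))
      (Real.exp (α - β / 2 * ‖x‖ ^ 2 + inner ℝ w x) • innerSL ℝ (w - β • x)) x := by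
  have h1 := ((hasStrictFDerivAt_norm_sq x).hasFDerivAt.const_mul (β / 2)).const_sub α
  have h2 := (h1.add (innerSL ℝ w).hasFDerivAt).exp
  refine h2.congr_fderiv ?_
  ext v
  simp only [innerSL_apply_apply, smul_apply, add_apply, neg_apply, inner_sub_left, inner_smul_left, smul_eq_mul, nsmul_eq_mul]
  simp
  ring_nf

lemma laplacian_exp_quadratic (α β : ℝ) (w x : EuclideanSpace ℝ (Fin N)) :
    Δ (fun z => Real.exp (α - β / 2 * ‖z‖ ^ 2 + inner ℝ w z)) x =
      Real.exp (α - β / 2 * ‖x‖ ^ 2 + inner ℝ w x) * (‖w - β • x‖ ^ 2 - N * β) := by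
  have h1 : fderiv ℝ (fun z => Real.exp (α - β / 2 * ‖z‖ ^ 2 + inner ℝ w z)) =
      fun z => Real.exp (α - β / 2 * ‖z‖ ^ 2 + inner ℝ w z) • innerSL ℝ (w - β • z) :=
    funext fun z => (hasFDerivAt_exp_quadratic α β w z).fderiv
  have h2 : HasFDerivAt (fun z : EuclideanSpace ℝ (Fin N) => innerSL ℝ (w - β • z))
      ((innerSL ℝ (E := EuclideanSpace ℝ (Fin N))).comp
        (-(β • ContinuousLinearMap.id ℝ (EuclideanSpace ℝ (Fin N))))) x :=
    (innerSL ℝ (E := EuclideanSpace ℝ (Fin N))).hasFDerivAt.comp x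
      (((hasFDerivAt_id x).const_smul β).const_sub w)
  have h3 := (hasFDerivAt_exp_quadratic α β w x).smul h2
  have h4 : ∀ v, iteratedFDeriv ℝ 2 (fun z => Real.exp (α - β / 2 * ‖z‖ ^ 2 + inner ℝ w z)) x
      ![v, v] = Real.exp (α - β / 2 * ‖x‖ ^ 2 + inner ℝ w x) *
        (‖inner ℝ (w - β • x) v‖ ^ 2 - β * ‖v‖ ^ 2) := by
    intro v
    rw [iteratedFDeriv_two_apply, h1]
    refine (congrArg (fun L => L v v) h3.fderiv).trans ?_
    simp only [smul_apply, add_apply, ContinuousLinearMap.comp_apply, neg_apply, map_neg, map_smul,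
      ContinuousLinearMap.id_apply, ContinuousLinearMap.smulRight_apply, innerSL_apply_apply,
      smul_eq_mul, real_inner_self_eq_norm_sq, Real.norm_eq_abs, sq_abs]
    ring
  rw [InnerProductSpace.laplacian_eq_iteratedFDeriv_orthonormalBasis _
    (EuclideanSpace.basisFun (Fin N) ℝ)]
  dsimp only
  simp_rw [h4]
  rw [← Finset.mul_sum, Finset.sum_sub_distrib, OrthonormalBasis.sum_sq_norm_inner_left]
  simp

lemma mehlerKernel_eq_mul_exp_quadratic (lam : ℝ) {t : ℝ} (x y : EuclideanSpace ℝ (Fin N)) :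
    mehlerKernel lam x t y = (lam / (2 * Real.pi * Real.sinh (lam * t))) ^ ((N : ℝ) / 2) *
      Real.exp (-(lam * Real.cosh (lam * t) / Real.sinh (lam * t) / 2 * ‖y‖ ^ 2) -
        lam * Real.cosh (lam * t) / Real.sinh (lam * t) / 2 * ‖x‖ ^ 2 +
          inner ℝ ((lam / Real.sinh (lam * t)) • y) x) := by
  unfold mehlerKernel
  rw [real_inner_smul_left, real_inner_comm]
  congr 2
  rcases eq_or_ne (Real.sinh (lam * t)) 0 with h | h
  · simp [h]
  · field_simp
    ring

lemma contDiff_mehlerKernel (lam t : ℝ) (y : EuclideanSpace ℝ (Fin N)) :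
    ContDiff ℝ 2 fun x => mehlerKernel lam x t y := by
  unfold mehlerKernel
  have h1 : ContDiff ℝ 2 fun x : EuclideanSpace ℝ (Fin N) => ‖x‖ ^ 2 := contDiff_norm_sq ℝ
  have h2 : ContDiff ℝ 2 fun x : EuclideanSpace ℝ (Fin N) => (inner ℝ x y : ℝ) :=
    contDiff_id.inner ℝ contDiff_const
  fun_prop

lemma laplacian_mehlerKernel (lam t : ℝ) (x y : EuclideanSpace ℝ (Fin N)) :
    Δ (fun ξ => mehlerKernel lam ξ t y) x = mehlerKernel lam x t y *
      (‖(lam / Real.sinh (lam * t)) • y -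
        (lam * Real.cosh (lam * t) / Real.sinh (lam * t)) • x‖ ^ 2 -
          N * (lam * Real.cosh (lam * t) / Real.sinh (lam * t))) := by
  rw [mehlerKernel_eq_mul_exp_quadratic, mul_assoc, ← laplacian_exp_quadratic, ← smul_eq_mul,
    ← InnerProductSpace.laplacian_smul]
  · refine congrFun (congrArg Laplacian.laplacian (funext fun ξ => ?_)) x
    exact mehlerKernel_eq_mul_exp_quadratic lam ξ y
  · have h1 : ContDiff ℝ 2 fun x : EuclideanSpace ℝ (Fin N) => ‖x‖ ^ 2 := contDiff_norm_sq ℝ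
    have h2 : ContDiff ℝ 2 fun x : EuclideanSpace ℝ (Fin N) =>
        (inner ℝ ((lam / Real.sinh (lam * t)) • y) x : ℝ) := contDiff_const.inner ℝ contDiff_id
    exact ContDiff.contDiffAt (by fun_prop)

lemma hasDerivAt_mehlerKernel (hlam : 0 < lam) {t : ℝ} (ht : 0 < t)
    (x y : EuclideanSpace ℝ (Fin N)) :
    HasDerivAt (fun τ => mehlerKernel lam x τ y)
      (1 / 2 * Δ (fun ξ => mehlerKernel lam ξ t y) x -
        harmonicPotential lam x * mehlerKernel lam x t y) t := by
  have hs := sinh_mul_pos hlam ht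
  have hpi := Real.pi_pos
  have hch := Real.cosh_sq (lam * t)
  have hlin : HasDerivAt (fun τ => lam * τ) lam t := by
    simpa using (hasDerivAt_id t).const_mul lam
  have hb : 0 < lam / (2 * Real.pi * Real.sinh (lam * t)) := by positivity
  have h0 : HasDerivAt (fun τ => lam / (2 * Real.pi * Real.sinh (lam * τ))) _ t :=
    (hasDerivAt_const t lam).div (hlin.sinh.const_mul (2 * Real.pi)) (by positivity)
  have h1 := h0.rpow_const (p := (N : ℝ) / 2) (Or.inl hb.ne')
  have h2 : HasDerivAt (fun τ => -(lam * (Real.cosh (lam * τ) * (‖x‖ ^ 2 + ‖y‖ ^ 2) -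
      2 * inner ℝ x y)) / (2 * Real.sinh (lam * τ))) _ t :=
    (((hlin.cosh.mul_const (‖x‖ ^ 2 + ‖y‖ ^ 2)).sub_const (2 * inner ℝ x y)).const_mul
      lam).neg.div (hlin.sinh.const_mul 2) (by positivity)
  refine (h1.mul h2.exp).congr_deriv ?_
  rw [laplacian_mehlerKernel, norm_sub_sq_real, norm_smul, norm_smul, mul_pow _ ‖y‖, mul_pow _ ‖x‖,
    Real.norm_eq_abs, Real.norm_eq_abs, sq_abs, sq_abs, real_inner_smul_left,
    real_inner_smul_right, real_inner_comm x y, Real.rpow_sub_one hb.ne']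
  simp only [Pi.neg_apply]
  unfold mehlerKernel harmonicPotential
  set G := (lam / (2 * Real.pi * Real.sinh (lam * t))) ^ ((N : ℝ) / 2)
  set E := Real.exp (-(lam * (Real.cosh (lam * t) * (‖x‖ ^ 2 + ‖y‖ ^ 2) - 2 * inner ℝ x y))
      / (2 * Real.sinh (lam * t)))
  set p : ℝ := inner ℝ x y
  field_simp
  -- Only the coefficient of ‖y‖² needs cosh² - sinh² = 1; the other terms agree identically.
  linear_combination G * E * lam ^ 3 * ‖y‖ ^ 2 * hch

lemma continuousOn_mehlerKernel (hlam : 0 < lam) :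
    ContinuousOn (fun p : EuclideanSpace ℝ (Fin N) × ℝ × EuclideanSpace ℝ (Fin N) =>
      mehlerKernel lam p.1 p.2.1 p.2.2) {p | 0 < p.2.1} := by
  unfold mehlerKernel
  have hs : ∀ p ∈ {p : EuclideanSpace ℝ (Fin N) × ℝ × EuclideanSpace ℝ (Fin N) | 0 < p.2.1},
      0 < Real.sinh (lam * p.2.1) := fun p hp => sinh_mul_pos hlam hp
  refine ContinuousOn.mul (ContinuousOn.rpow_const (ContinuousOn.div (by fun_prop) (by fun_prop)
    fun p hp => ?_) fun p hp => Or.inl ?_) (ContinuousOn.rexp (ContinuousOn.div (by fun_prop)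
      (by fun_prop) fun p hp => ?_))
  · have := hs p hp; positivity
  · have := hs p hp; positivity
  · have := hs p hp; positivity

/-- Moving all the t-dependence into the integrand, against a fixed Gaussian measure, prepares for
dominated convergence as t → 0. -/
lemma integral_mehlerKernel_mul (hlam : 0 < lam) {t : ℝ} (ht : 0 < t)
    (x : EuclideanSpace ℝ (Fin N)) {f : EuclideanSpace ℝ (Fin N) → ℝ} (hf : Continuous f) :
    ∫ y, mehlerKernel lam x t y * f y = Real.cosh (lam * t) ^ (-(N : ℝ) / 2) *
      Real.exp (-(lam * Real.sinh (lam * t) * ‖x‖ ^ 2) / (2 * Real.cosh (lam * t))) *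
        ∫ w, f (√(Real.sinh (lam * t) / (lam * Real.cosh (lam * t))) • w +
          (Real.cosh (lam * t))⁻¹ • x) ∂stdGaussian (EuclideanSpace ℝ (Fin N)) := by
  have hs := sinh_mul_pos hlam ht
  have hc := Real.cosh_pos (lam * t)
  set v := Real.sinh (lam * t) / (lam * Real.cosh (lam * t)) with hv
  have hv0 : 0 < v := by positivity
  have h1 : ∫ w, f (√v • w + (Real.cosh (lam * t))⁻¹ • x)
      ∂stdGaussian (EuclideanSpace ℝ (Fin N)) =
      ∫ w, f (w + (Real.cosh (lam * t))⁻¹ • x) ∂heatMeasure N v := by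
    unfold heatMeasure
    have hg : Continuous fun w => f (w + (Real.cosh (lam * t))⁻¹ • x) :=
      hf.comp (continuous_add_const _)
    rw [integral_map (by fun_prop) hg.aestronglyMeasurable]
  rw [h1, integral_heatMeasure hv0, ← integral_add_right_eq_self _ ((Real.cosh (lam * t))⁻¹ • x),
    ← integral_const_mul]
  congr with w
  rw [mehlerKernel_eq_mul_heatDensity hlam ht, add_sub_cancel_right, mul_assoc]

lemma tendsto_integral_mehlerKernel_mul (hlam : 0 < lam) {f : EuclideanSpace ℝ (Fin N) → ℝ}
    (hf : Continuous f) (hb : ∃ C, ∀ x, ‖f x‖ ≤ C) (x : EuclideanSpace ℝ (Fin N)) :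
    Tendsto (fun t => ∫ y, mehlerKernel lam x t y * f y) (𝓝[>] 0) (𝓝 (f x)) := by
  obtain ⟨C, hC⟩ := hb
  have hc : ∀ t, Real.cosh (lam * t) ≠ 0 := fun t => (Real.cosh_pos _).ne'
  -- Unlike the kernel, this expression is regular at t = 0, where the variance is 0, the hyperbolic
  -- cosine is 1 and the value is f(x).
  have h0 : ContinuousAt (fun t => Real.cosh (lam * t) ^ (-(N : ℝ) / 2) *
      Real.exp (-(lam * Real.sinh (lam * t) * ‖x‖ ^ 2) / (2 * Real.cosh (lam * t))) *
        ∫ w, f (√(Real.sinh (lam * t) / (lam * Real.cosh (lam * t))) • w +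
          (Real.cosh (lam * t))⁻¹ • x) ∂stdGaussian (EuclideanSpace ℝ (Fin N))) 0 := by
    refine ContinuousAt.mul (Continuous.continuousAt ?_) (Continuous.continuousAt ?_)
    · refine Continuous.mul (Continuous.rpow_const (by fun_prop) fun t => Or.inl (hc t))
        (Real.continuous_exp.comp (Continuous.div (by fun_prop) (by fun_prop) fun t => ?_))
      exact mul_ne_zero two_ne_zero (hc t)
    · refine continuous_of_dominated (bound := fun _ => C) (fun t => ?_)
        (fun t => ae_of_all _ fun w => hC _) (integrable_const C) (ae_of_all _ fun w => ?_)
      · exact (hf.comp (by fun_prop)).aestronglyMeasurable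
      · refine hf.comp (Continuous.add (Continuous.smul (Real.continuous_sqrt.comp
          (Continuous.div (by fun_prop) (by fun_prop) fun t => ?_)) continuous_const)
          (Continuous.smul (Continuous.inv₀ (by fun_prop) hc) continuous_const))
        exact mul_ne_zero hlam.ne' (hc t)
  have h1 := h0.tendsto.mono_left (nhdsWithin_le_nhds (s := Set.Ioi (0 : ℝ)))
  simp only [mul_zero, Real.cosh_zero, Real.sinh_zero, Real.one_rpow, zero_mul, neg_zero, zero_div,
    Real.exp_zero, mul_one, Real.sqrt_zero, zero_smul, inv_one, one_smul, zero_add, one_mul,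
    integral_const, probReal_univ, smul_eq_mul] at h1
  refine h1.congr' ?_
  filter_upwards [self_mem_nhdsWithin] with t ht
  exact (integral_mehlerKernel_mul hlam ht x hf).symm

lemma isGreenFunction_mehlerKernel (hlam : 0 < lam) :
    IsGreenFunction (N := N) (harmonicPotential lam) (mehlerKernel lam) where
  pos x _ y ht := mehlerKernel_pos hlam ht x y
  continuousOn := continuousOn_mehlerKernel hlam
  contDiff _ y _ := contDiff_mehlerKernel lam _ y
  equation x _ y ht := hasDerivAt_mehlerKernel hlam ht x y
  initial _ hf hcs x := tendsto_integral_mehlerKernel_mul hlam hf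
    (hcs.exists_bound_of_continuous hf) x

end Green

end BernsteinBridge

theorem proposition3 (N : ℕ) (hN : 0 < N) (T : ℝ) (hT : 0 < T) (lam : ℝ) (hlam : 0 < lam)
    (a : EuclideanSpace ℝ (Fin N)) :
    -- the Mehler kernel is the Green function of the harmonic heat equation
    BernsteinBridge.IsGreenFunction (N := N) (BernsteinBridge.harmonicPotential lam)
      (BernsteinBridge.mehlerKernel lam) ∧
    -- the associated Bernstein process exists
    (∃ (Ω : Type) (_ : MeasurableSpace Ω) (P : Measure Ω)
        (Z : Set.Icc (0 : ℝ) T → Ω → EuclideanSpace ℝ (Fin N)),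
      IsProbabilityMeasure P ∧ P.IsComplete ∧
      BernsteinBridge.IsAssociatedBernsteinProcess (BernsteinBridge.mehlerKernel lam) hT.le
        (BernsteinBridge.diracDatum lam T a 0) (BernsteinBridge.diracDatum lam T a a) Z P) ∧
    -- every realization of it has the stated properties
    ∀ (Ω : Type*) [MeasurableSpace Ω] (P : Measure Ω) [IsProbabilityMeasure P]
      (Z : Set.Icc (0 : ℝ) T → Ω → EuclideanSpace ℝ (Fin N)),
      BernsteinBridge.IsAssociatedBernsteinProcess (BernsteinBridge.mehlerKernel lam) hT.le
        (BernsteinBridge.diracDatum lam T a 0) (BernsteinBridge.diracDatum lam T a a) Z P →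
      -- Gaussian and Markovian
      IsGaussianProcess Z P ∧
      BernsteinBridge.IsMarkovProcess Z P ∧
      -- one-dimensional marginals
      (∀ t : Set.Icc (0 : ℝ) T, 0 < (t : ℝ) → (t : ℝ) < T →
        ∀ A : Set (EuclideanSpace ℝ (Fin N)), MeasurableSet A →
          P.real {ω | Z t ω ∈ A} =
            (2 * Real.pi * BernsteinBridge.bridgeVar lam T t) ^ (-(N : ℝ) / 2) *
              ∫ x in A, Real.exp (-‖x - BernsteinBridge.bridgeMean lam T a t‖ ^ 2 /
                (2 * BernsteinBridge.bridgeVar lam T t))) ∧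
      -- pinned at both ends
      P {ω | Z ⟨0, Set.left_mem_Icc.mpr hT.le⟩ ω = 0} = 1 ∧
      P {ω | Z ⟨T, Set.right_mem_Icc.mpr hT.le⟩ ω = a} = 1 ∧
      -- mean
      (∀ t : Set.Icc (0 : ℝ) T, Integrable (Z t) P ∧
        ∫ ω, Z t ω ∂P = BernsteinBridge.bridgeMean lam T a t) ∧
      -- covariance
      (∀ (s t : Set.Icc (0 : ℝ) T) (i j : Fin N),
        Integrable (fun ω => (Z s ω i - BernsteinBridge.bridgeMean lam T a s i) *
          (Z t ω j - BernsteinBridge.bridgeMean lam T a t j)) P ∧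
        ∫ ω, (Z s ω i - BernsteinBridge.bridgeMean lam T a s i) *
          (Z t ω j - BernsteinBridge.bridgeMean lam T a t j) ∂P =
          Real.sinh (lam * (T - max (s : ℝ) (t : ℝ))) * Real.sinh (lam * min (s : ℝ) (t : ℝ)) /
            (lam * Real.sinh (lam * T)) * (if i = j then 1 else 0)) ∧
      -- non-stationary
      ¬ BernsteinBridge.IsStationary Z P ∧
      -- maximal randomness exactly at the middle of the time interval
      (∀ i : Fin N,
        Var[fun ω => Z ⟨T / 2, by constructor <;> linarith⟩ ω i; P] =
          Real.sinh (lam * T / 2) ^ 2 / (lam * Real.sinh (lam * T)) ∧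
        ∀ t : Set.Icc (0 : ℝ) T, (t : ℝ) ≠ T / 2 →
          Var[fun ω => Z t ω i; P] <
            Var[fun ω => Z ⟨T / 2, by constructor <;> linarith⟩ ω i; P]) := by
  refine ⟨BernsteinBridge.isGreenFunction_mehlerKernel hlam,
    BernsteinBridge.exists_isAssociatedBernsteinProcess hlam hT a, fun Ω _ P _ Z h => ?_⟩
  have hends := BernsteinBridge.ae_endpoints_of_isAssociated hlam hT h
  have hlaw := BernsteinBridge.hasLaw_sub_bridgeMean_of_isAssociated hlam hT h
  have hint : ∀ t, Integrable (Z t) P := fun t => by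
    have := (hlaw t).hasGaussianLaw.integrable.add
      (integrable_const (BernsteinBridge.bridgeMean lam T a t))
    exact this.congr (ae_of_all _ fun ω => sub_add_cancel _ _)
  refine ⟨BernsteinBridge.isGaussianProcess_of_isAssociated hlam hT h,
    BernsteinBridge.isMarkovProcess_of_isAssociated hlam hT h,
    fun t ht0 htT A hA => BernsteinBridge.measureReal_mem_of_isAssociated hlam hT h t ht0 htT hA,
    ?_, ?_, fun t => ⟨hint t, ?_⟩, fun s t i j => ⟨?_, ?_⟩,
    BernsteinBridge.not_isStationary_of_isAssociated hN hlam hT h, fun i => ⟨?_, fun t ht => ?_⟩⟩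
  · rw [← measure_univ (μ := P)]
    exact measure_congr (eventuallyEq_univ.mpr (hends.mono fun ω hω => hω.1))
  · rw [← measure_univ (μ := P)]
    exact measure_congr (eventuallyEq_univ.mpr (hends.mono fun ω hω => hω.2))
  · have h0 := BernsteinBridge.integral_eq_zero_of_hasLaw (hlaw t)
    rw [integral_sub (hint t) (integrable_const _), integral_const, probReal_univ, one_smul] at h0
    exact sub_eq_zero.mp h0
  · exact (BernsteinBridge.memLp_apply_of_hasLaw (hlaw s) i).integrable_mul
      (BernsteinBridge.memLp_apply_of_hasLaw (hlaw t) j)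
  · exact BernsteinBridge.integral_mul_of_isAssociated hlam hT h s t i j
  · rw [BernsteinBridge.variance_apply_of_isAssociated hlam hT h, BernsteinBridge.bridgeVar_half]
  · rw [BernsteinBridge.variance_apply_of_isAssociated hlam hT h,
      BernsteinBridge.variance_apply_of_isAssociated hlam hT h]
    exact BernsteinBridge.bridgeVar_lt_bridgeVar_half hlam hT ht
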